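/- Let $\mathbb F$ be an algebraically closed field, $n\ge 1$ and $d\ge 0$. For $m\ge 1$ let $\operatorname{Rep}(GL_m)$ be the category of rational representations of $GL_m=GL_m(\mathbb F)$, i.e. of finite-dimensional representations whose matrix coefficients are polynomials in the matrix entries and $\det^{-1}$, and let $\operatorname{Rep}^d(GL_m)$ be its full subcategory of polynomial representations of degree $d$: those $M$ all of whose weights $\mu\in\mathbb Z^m$ with respect to the torus of diagonal matrices satisfy $\mu_1,\dots,\mu_m\ge 0$ and $\mu_1+\dots+\mu_m=d$. For a dominant weight $\lambda=(\lambda_1\ge\dots\ge\lambda_m)\in\mathbb Z^m$ let $\Delta(\lambda)$ be the Weyl module, i.e. the universal rational representation with a vector $v_\lambda$ such that $b\,v_\lambda=\prod_i b_{ii}^{\lambda_i}\,v_\lambda$ for all upper triangular $b\in GL_m$ (for every $N\in\operatorname{Rep}(GL_m)$ and every $u\in N$ with $b\,u=\prod_i b_{ii}^{\lambda_i}\,u$ for all upper triangular $b$ there is a unique homomorphism $\Delta(\lambda)\to N$ with $v_\lambda\mapsto u$), and let $L(\lambda)=\Delta(\lambda)/R$, where $R$ is the sum of all submodules of $\Delta(\lambda)$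 not containing $v_\lambda$. Let $S=\{\operatorname{diag}(1,\dots,1,t) : t\in\mathbb F^\times\}\subset GL_{n+1}$. If $M\in\operatorname{Rep}^d(GL_{n+1})$, then the space $M^S$ of $S$-invariants, with the action of $GL_n$ embedded in the upper left corner of $GL_{n+1}$, lies in $\operatorname{Rep}^d(GL_n)$, so that there is a functor $$\tau_n^{n+1}:\operatorname{Rep}^d(GL_{n+1})\to\operatorname{Rep}^d(GL_n),\qquad M\mapsto M^S .$$ Then: 1. $\tau_n^{n+1}$ is exact. 2. For every $\lambda=(\lambda_1\ge\dots\ge\lambda_n\ge 0)\in\mathbb Z^n$ with $\lambda_1+\dots+\lambda_n=d$, the modules $\Delta(\lambda,0)$ and $L(\lambda,0)$ lie in $\operatorname{Rep}^d(GL_{n+1})$, the modules $\Delta(\lambda)$ and $L(\lambda)$ lie in $\operatorname{Rep}^d(GL_n)$, and $\tau_n^{n+1}(\Delta(\lambda,0))\cong\Delta(\lambda)$ and $\tau_n^{n+1}(L(\lambda,0))\cong L(\lambda)$. 3. If $n\ge d$, then $\tau_n^{n+1}$ is an equivalence of categories. Consequently the stable category $\operatorname{Rep}^d(GL):=\operatorname{Rep}^d(GL_{\max(1,d)})$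 is equivalent to $\operatorname{Rep}^d(GL_m)$ for every $m\ge\max(1,d)$, through the composite $\tau_{\max(1,d)}^{\max(1,d)+1}\circ\dots\circ\tau_{m-1}^{m}:\operatorname{Rep}^d(GL_m)\to\operatorname{Rep}^d(GL)$. -/

import Mathlib

open CategoryTheory CategoryTheory.Limits
open scoped MonoidAlgebra

universe u

noncomputable section

namespace PolyGL

variable {F : Type u} [Field F] {n : ℕ}

/-- The diagonal matrix `diag(t₁, …, tₙ)`, an element of the maximal torus `T ⊆ GL_n`. -/
def diag (t : Fin n → Fˣ) : GL (Fin n) F where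
  val := Matrix.diagonal fun i => (t i : F)
  inv := Matrix.diagonal fun i => ((t i)⁻¹ : Fˣ)
  val_inv := by simp [Matrix.diagonal_mul_diagonal]
  inv_val := by simp [Matrix.diagonal_mul_diagonal]

/-- The element `diag(1, …, 1, s)` of the one-dimensional subtorus `S ⊆ GL_{n+1}`. -/
def subtorus (s : Fˣ) : GL (Fin (n + 1)) F :=
  diag (Fin.snoc (fun _ => (1 : Fˣ)) s : Fin (n + 1) → Fˣ)

/-- The block matrix with diagonal blocks `A` and `1`. -/
def blockHom : Matrix (Fin n) (Fin n) F →* Matrix (Fin (n + 1)) (Fin (n + 1)) F where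
  toFun A := Matrix.reindex finSumFinEquiv finSumFinEquiv
    (Matrix.fromBlocks A 0 0 (1 : Matrix (Fin 1) (Fin 1) F))
  map_one' := by simp
  map_mul' A B := by
    simp [Matrix.submatrix_mul_equiv, Matrix.fromBlocks_multiply]

/-- The standard embedding `GL_n → GL_{n+1}` into the upper left corner. -/
def embed : GL (Fin n) F →* GL (Fin (n + 1)) F := Units.map blockHom

/-- The character `b ↦ ∏ bᵢᵢ ^ λᵢ` of the group of upper triangular matrices (as a function on
all of `GL_n`; only its values at upper triangular matrices are used). -/
def borelChar (wt : Fin n → ℤ) (b : GL (Fin n) F) : F := ∏ i, b.val i i ^ wt i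

section Properties

variable {V : Type*} [AddCommGroup V] [Module F V]

/-- Rational representations of `GL_n`: finite dimensional, with all matrix coefficients
polynomials in the matrix entries and `det⁻¹`. -/
structure IsRational (ρ : Representation F (GL (Fin n) F) V) : Prop where
  finite : Module.Finite F V
  coeff : ∀ (φ : Module.Dual F V) (v : V),
    ∃ (P : MvPolynomial (Fin n × Fin n) F) (k : ℕ), ∀ g : GL (Fin n) F,
      φ (ρ g v) = MvPolynomial.eval (fun ij => g.val ij.1 ij.2) P * (g.val.det ^ k)⁻¹

/-- The weight space `V_μ` for the torus of diagonal matrices. -/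
def weightSpace (ρ : Representation F (GL (Fin n) F) V) (μ : Fin n → ℤ) : Submodule F V where
  carrier := {v | ∀ t : Fin n → Fˣ, ρ (diag t) v = (∏ i, (t i : F) ^ μ i) • v}
  add_mem' ha hb t := by simp [ha t, hb t]
  zero_mem' t := by simp
  smul_mem' c v hv t := by simp [hv t, smul_comm c]

/-- Polynomial representations of degree `d`: rational representations all of whose weights
`μ` satisfy `μ₁, …, μₙ ≥ 0` and `μ₁ + ⋯ + μₙ = d`. -/
structure IsPolynomial (d : ℕ) (ρ : Representation F (GL (Fin n) F) V) : Prop where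
  rational : IsRational ρ
  weights : ∀ μ : Fin n → ℤ, weightSpace ρ μ ≠ ⊥ → (∀ i, 0 ≤ μ i) ∧ ∑ i, μ i = d

/-- The subspace `V^S` of `S`-invariants in a representation of `GL_{n+1}`. -/
def invariants (ρ : Representation F (GL (Fin (n + 1)) F) V) : Submodule F V where
  carrier := {v | ∀ s : Fˣ, ρ (subtorus s) v = v}
  add_mem' ha hb s := by simp [ha s, hb s]
  zero_mem' s := by simp
  smul_mem' c v hv s := by simp [hv s]

end Properties

/-! ### The categories of polynomial representations -/

section Categories

variable (F n)

/-- The property of being a polynomial representation of degree `d`. -/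
def polProp (d : ℕ) : ObjectProperty (Rep.{u} F (GL (Fin n) F)) :=
  fun M => IsPolynomial d M.ρ

/-- `Rep^d(GL_n)`, a full subcategory of the category of representations of `GL_n`. -/
abbrev PolRep (d : ℕ) := (polProp F n d).FullSubcategory

end Categories

/-! ### Weyl modules and irreducible modules -/

/-- The left ideal of `F[GL_n]` defining the Weyl module `Δ(λ)`: the intersection of all left
ideals `J` that contain `b - λ(b)` for every upper triangular `b` and whose quotient `F[GL_n]/J`
is a rational representation. Modulo it, `1` is the universal vector on which the upper triangular
matrices act through `λ` (see `weyl_universal`). -/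
def weylIdeal (wt : Fin n → ℤ) :
    Submodule (F[GL (Fin n) F]) (F[GL (Fin n) F]) :=
  sInf {J | (∀ b : GL (Fin n) F, b.val.BlockTriangular id →
      MonoidAlgebra.single b (1 : F) - MonoidAlgebra.single 1 (borelChar wt b) ∈ J) ∧
    IsRational (Representation.ofModule' (k := F) (G := GL (Fin n) F) (F[GL (Fin n) F] ⧸ J))}

/-- The Weyl module `Δ(λ)` as a module over the group algebra. -/
abbrev WeylMod (F : Type u) [Field F] {n : ℕ} (wt : Fin n → ℤ) : Type u :=
  (F[GL (Fin n) F]) ⧸ (weylIdeal (F := F) wt)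

/-- The generator (highest weight vector) `v_λ` of `Δ(λ)`. -/
def weylVec (wt : Fin n → ℤ) : WeylMod F wt := Submodule.Quotient.mk 1

/-- The sum `R` of all submodules of `Δ(λ)` not containing `v_λ`. -/
def weylRad (wt : Fin n → ℤ) : Submodule (F[GL (Fin n) F]) (WeylMod F wt) :=
  sSup {N | weylVec wt ∉ N}

variable (F) in
/-- The Weyl module `Δ(λ)`: the universal representation of `GL_n` generated by a vector on which
the upper triangular matrices act through `λ`. -/
abbrev weyl (wt : Fin n → ℤ) : Rep.{u} F (GL (Fin n) F) :=
  Rep.of (Representation.ofModule' (k := F) (G := GL (Fin n) F) (WeylMod F wt))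

variable (F) in
/-- The irreducible module `L(λ) = Δ(λ)/R`. -/
abbrev irr (wt : Fin n → ℤ) : Rep.{u} F (GL (Fin n) F) :=
  Rep.of (Representation.ofModule' (k := F) (G := GL (Fin n) F)
    (WeylMod F wt ⧸ weylRad (F := F) wt))

/-- Subrepresentations of rational representations, in the form of injective intertwining maps,
are rational. -/
lemma IsRational.of_injective {V W : Type*} [AddCommGroup V] [Module F V] [AddCommGroup W]
    [Module F W] {ρ : Representation F (GL (Fin n) F) V} {σ : Representation F (GL (Fin n) F) W}
    (hσ : IsRational σ) (f : V →ₗ[F] W) (hf : Function.Injective f)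
    (hfρ : ∀ g v, f (ρ g v) = σ g (f v)) : IsRational ρ := by
  have := hσ.finite
  refine ⟨Module.Finite.of_injective f hf, fun φ v => ?_⟩
  obtain ⟨r, hr⟩ := f.exists_leftInverse_of_injective (LinearMap.ker_eq_bot.2 hf)
  obtain ⟨P, k, hP⟩ := hσ.coeff (φ ∘ₗ r) (f v)
  refine ⟨P, k, fun g => ?_⟩
  rw [← hP g, ← hfρ]
  have h := LinearMap.congr_fun hr (ρ g v)
  simp only [LinearMap.comp_apply, LinearMap.id_apply] at h
  simp [h]

/-- The universal property that characterizes `Δ(λ)`: a vector `m` of a rational representation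
with `b m = λ(b) m` for all upper triangular `b` is the image of `v_λ` under a unique
homomorphism. -/
lemma weyl_universal (wt : Fin n → ℤ) (M : Rep.{u} F (GL (Fin n) F)) (hM : IsRational M.ρ)
    (m : M.V) (hm : ∀ b : GL (Fin n) F, b.val.BlockTriangular id → M.ρ b m = borelChar wt b • m) :
    ∃! f : weyl F wt ⟶ M, f.hom (weylVec (F := F) wt) = m := by
  let e : F[GL (Fin n) F] →ₗ[F[GL (Fin n) F]] M.ρ.asModule :=
    LinearMap.toSpanSingleton _ _ (M.ρ.asModuleEquiv.symm m)
  have he : ∀ x, M.ρ.asModuleEquiv (e x) = M.ρ.asAlgebraHom x m := fun x => by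
    simp [e, Representation.asModuleEquiv_map_smul]
  have hle : weylIdeal (F := F) wt ≤ LinearMap.ker e := by
    refine sInf_le ⟨fun b hb => ?_, ?_⟩
    · rw [LinearMap.mem_ker]
      apply M.ρ.asModuleEquiv.injective
      rw [he]
      simp [Representation.asAlgebraHom_single, hm b hb]
    · refine hM.of_injective
        (M.ρ.asModuleEquiv.toLinearMap ∘ₗ
          ((LinearMap.ker e).liftQ e le_rfl).restrictScalars F) ?_ ?_
      · refine M.ρ.asModuleEquiv.injective.comp ?_
        exact LinearMap.ker_eq_bot.1 (Submodule.ker_liftQ_eq_bot _ e le_rfl le_rfl)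
      · intro g v
        obtain ⟨x, rfl⟩ := Submodule.Quotient.mk_surjective _ v
        change M.ρ.asModuleEquiv (e (MonoidAlgebra.single g 1 • x)) =
          M.ρ g (M.ρ.asModuleEquiv (e x))
        rw [he, he, smul_eq_mul, map_mul]
        simp [Representation.asAlgebraHom_single]
  refine ⟨Rep.ofHom
    { toLinearMap := M.ρ.asModuleEquiv.toLinearMap ∘ₗ
        ((weylIdeal (F := F) wt).liftQ e hle).restrictScalars F
      isIntertwining' := ?_ }, ?_, ?_⟩
  · intro g
    refine LinearMap.ext fun v => ?_
    obtain ⟨x, rfl⟩ := Submodule.Quotient.mk_surjective _ v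
    change M.ρ.asModuleEquiv (e (MonoidAlgebra.single g 1 • x)) =
      M.ρ g (M.ρ.asModuleEquiv (e x))
    rw [he, he, smul_eq_mul, map_mul]
    simp [Representation.asAlgebraHom_single]
  · change M.ρ.asModuleEquiv (e 1) = m
    rw [he]; simp
  · intro f hf
    have key : ∀ q : WeylMod F wt →ₗ[F] M.V,
        (∀ g x, q (MonoidAlgebra.single g (1 : F) • x) = M.ρ g (q x)) → q (weylVec wt) = m →
        ∀ x, q ((weylIdeal wt).mkQ x) = M.ρ.asAlgebraHom x m := by
      intro q hq hqm x
      induction x using MonoidAlgebra.induction_linear with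
      | zero => simp
      | add x y hx hy => rw [map_add, map_add, map_add, LinearMap.add_apply, hx, hy]
      | single g a =>
        have h1 : (weylIdeal (F := F) wt).mkQ (MonoidAlgebra.single g a) =
            a • (MonoidAlgebra.single g (1 : F) • weylVec wt) := by
          change _ = a • (weylIdeal (F := F) wt).mkQ (MonoidAlgebra.single g 1 • 1)
          rw [← LinearMap.map_smul_of_tower]; simp
        rw [h1, map_smul, hq, hqm]
        simp [Representation.asAlgebraHom_single]
    apply Rep.hom_ext
    apply Representation.IntertwiningMap.ext
    refine LinearMap.ext fun v => ?_
    obtain ⟨x, rfl⟩ := Submodule.Quotient.mk_surjective _ v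
    exact (key f.hom.toLinearMap (fun g x => Rep.hom_comm_apply f g x) hf x).trans (he x).symm

/-! ### The functor of `S`-invariants -/

lemma embed_last_last (g : GL (Fin n) F) :
    (embed g).val (Fin.last n) (Fin.last n) = 1 := by
  have h : (Fin.last n) = finSumFinEquiv (Sum.inr (0 : Fin 1)) := by
    ext; simp
  rw [h]; simp [embed, blockHom]

lemma embed_castSucc (g : GL (Fin n) F) (i j : Fin n) :
    (embed g).val i.castSucc j.castSucc = g.val i j := by
  have h : ∀ i : Fin n, i.castSucc = finSumFinEquiv (Sum.inl i : Fin n ⊕ Fin 1) := by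
    intro i; ext; simp
  rw [h, h]; simp [embed, blockHom]

lemma embed_castSucc_last (g : GL (Fin n) F) (i : Fin n) :
    (embed g).val i.castSucc (Fin.last n) = 0 := by
  have h : ∀ i : Fin n, i.castSucc = finSumFinEquiv (Sum.inl i : Fin n ⊕ Fin 1) := by
    intro i; ext; simp
  have h' : (Fin.last n) = finSumFinEquiv (Sum.inr (0 : Fin 1)) := by
    ext; simp
  rw [h, h']; simp [embed, blockHom]

lemma embed_last_castSucc (g : GL (Fin n) F) (i : Fin n) :
    (embed g).val (Fin.last n) i.castSucc = 0 := by
  have h : ∀ i : Fin n, i.castSucc = finSumFinEquiv (Sum.inl i : Fin n ⊕ Fin 1) := by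
    intro i; ext; simp
  have h' : (Fin.last n) = finSumFinEquiv (Sum.inr (0 : Fin 1)) := by
    ext; simp
  rw [h, h']; simp [embed, blockHom]

lemma embed_det (g : GL (Fin n) F) : (embed g).val.det = g.val.det := by
  simp [embed, blockHom]

lemma subtorus_comm (g : GL (Fin n) F) (s : Fˣ) :
    subtorus s * embed g = embed g * subtorus s := by
  apply Units.ext
  ext i j
  simp only [subtorus, diag, Units.val_mul, Matrix.diagonal_mul, Matrix.mul_diagonal]
  refine Fin.lastCases ?_ (fun i => ?_) i <;> refine Fin.lastCases ?_ (fun j => ?_) j <;>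
    simp [embed_castSucc_last, embed_last_castSucc, mul_comm]

lemma diag_snoc (t : Fin n → Fˣ) (s : Fˣ) :
    diag (Fin.snoc t s : Fin (n + 1) → Fˣ) = embed (diag t) * subtorus s := by
  apply Units.ext
  ext i j
  simp only [subtorus, Units.val_mul]
  simp only [diag, Matrix.mul_diagonal]
  change _ = (embed (diag t)).val i j * _
  refine Fin.lastCases ?_ (fun i => ?_) i <;> refine Fin.lastCases ?_ (fun j => ?_) j
  · simp [embed_last_last]
  · simp [embed_last_castSucc, Matrix.diagonal_apply, Fin.ext_iff]; omega
  · simp [embed_castSucc_last, Matrix.diagonal_apply, Fin.ext_iff]; omega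
  · simp [embed_castSucc, diag, Matrix.diagonal_apply]

section Inv

variable {V : Type*} [AddCommGroup V] [Module F V]

/-- The representation of `GL_n` on `V^S`. -/
def invRep (ρ : Representation F (GL (Fin (n + 1)) F) V) :
    Representation F (GL (Fin n) F) (invariants ρ) where
  toFun g := (ρ (embed g)).restrict (p := invariants ρ) (q := invariants ρ) (by
    intro v hv s
    have h : ρ (subtorus s * embed g) v = ρ (embed g * subtorus s) v := by rw [subtorus_comm]
    simpa [hv s] using h)
  map_one' := by ext; simp
  map_mul' x y := by
    ext v
    change ρ (embed (x * y)) v.1 = ρ (embed x) (ρ (embed y) v.1)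
    simp

@[simp]
lemma invRep_coe (ρ : Representation F (GL (Fin (n + 1)) F) V) (g : GL (Fin n) F)
    (v : invariants ρ) : ((invRep ρ g v : invariants ρ) : V) = ρ (embed g) v := rfl

lemma invRep_isPolynomial {d : ℕ} {ρ : Representation F (GL (Fin (n + 1)) F) V}
    (h : IsPolynomial d ρ) : IsPolynomial d (invRep ρ) := by
  have := h.rational.finite
  refine ⟨⟨inferInstance, fun φ v => ?_⟩, fun μ hμ => ?_⟩
  · obtain ⟨ψ, hψ⟩ := LinearMap.exists_extend φ
    obtain ⟨P, k, hP⟩ := h.rational.coeff ψ v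
    let f : Fin (n + 1) × Fin (n + 1) → MvPolynomial (Fin n × Fin n) F := fun ij =>
      Fin.lastCases (motive := fun _ => MvPolynomial (Fin n × Fin n) F)
        (Fin.lastCases (motive := fun _ => MvPolynomial (Fin n × Fin n) F) 1 (fun _ => 0) ij.2)
        (fun i => Fin.lastCases (motive := fun _ => MvPolynomial (Fin n × Fin n) F)
          0 (fun j => MvPolynomial.X (i, j)) ij.2) ij.1
    refine ⟨MvPolynomial.bind₁ f P, k, fun g => ?_⟩
    have h1 : φ (invRep ρ g v) = ψ (ρ (embed g) v) := by
      rw [← hψ]; rfl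
    rw [h1, hP, embed_det]
    congr 1
    have hb : MvPolynomial.eval (fun ij => g.val ij.1 ij.2) (MvPolynomial.bind₁ f P) =
        MvPolynomial.eval
          (fun ij => MvPolynomial.eval (fun ij => g.val ij.1 ij.2) (f ij)) P :=
      MvPolynomial.eval₂Hom_bind₁ (RingHom.id F) _ f P
    rw [hb]
    congr 2
    funext ⟨i, j⟩
    refine Fin.lastCases ?_ (fun i => ?_) i <;> refine Fin.lastCases ?_ (fun j => ?_) j <;>
      simp [f, embed_castSucc, embed_castSucc_last, embed_last_castSucc, embed_last_last]
  · obtain ⟨v, hv, hv0⟩ := (Submodule.ne_bot_iff _).1 hμ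
    have key : weightSpace ρ (Fin.snoc μ 0 : Fin (n + 1) → ℤ) ≠ ⊥ := by
      refine (Submodule.ne_bot_iff _).2 ⟨v, fun t => ?_, by simpa using hv0⟩
      have ht : t = Fin.snoc (Fin.init t) (t (Fin.last n)) := (Fin.snoc_init_self t).symm
      have h2 := congrArg Subtype.val (hv (Fin.init t))
      simp only [invRep_coe, Submodule.coe_smul] at h2
      have h3 : ρ (subtorus (t (Fin.last n))) v = v := v.2 _
      rw [Fin.prod_univ_castSucc]
      conv_lhs => rw [ht, diag_snoc, map_mul]
      simp [h3, h2, Fin.init]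
    obtain ⟨h1, h2⟩ := h.weights _ key
    refine ⟨fun i => by simpa using h1 i.castSucc, ?_⟩
    rw [Fin.sum_univ_castSucc] at h2
    simpa using h2

end Inv

variable (F n)

/-- The functor `M ↦ M^S` from representations of `GL_{n+1}` to representations of `GL_n`. -/
def invFunctor : Rep.{u} F (GL (Fin (n + 1)) F) ⥤ Rep.{u} F (GL (Fin n) F) where
  obj M := Rep.of (invRep M.ρ)
  map {M N} f := Rep.ofHom
    { toLinearMap := f.hom.toLinearMap.restrict (p := invariants M.ρ) (q := invariants N.ρ) (by
        intro v hv s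
        have h := Rep.hom_comm_apply f (subtorus s) v
        rw [hv s] at h
        exact h.symm)
      isIntertwining' := by
        intro g
        ext v
        exact Rep.hom_comm_apply f (embed g) v.1 }
  map_id M := by ext; rfl
  map_comp f g := by ext; rfl

/-- The functor `τ_n^{n+1} : Rep^d(GL_{n+1}) ⥤ Rep^d(GL_n)`, `M ↦ M^S`. -/
def tau (d : ℕ) : PolRep F (n + 1) d ⥤ PolRep F n d :=
  (polProp F n d).lift ((polProp F (n + 1) d).ι ⋙ invFunctor F n)
    fun M => invRep_isPolynomial M.property

/-- The composition `Rep^d(GL_{n+k}) ⥤ ⋯ ⥤ Rep^d(GL_{n+1}) ⥤ Rep^d(GL_n)` of the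
functors `τ`. -/
def tauIter (d : ℕ) : (k : ℕ) → PolRep F (n + k) d ⥤ PolRep F n d
  | 0 => 𝟭 _
  | k + 1 => tau F (n + k) d ⋙ tauIter d k

/-- The stable category `Rep^d(GL)`, realized as `Rep^d(GL_n)` for the least positive `n`
with `n ≥ d`. -/
abbrev StableRep (d : ℕ) := PolRep F (max 1 d) d

end PolyGL

end

noncomputable section

namespace PolyGL

variable {F : Type u} [Field F]

/-! ### Polynomials in matrix entries -/

section Polynomials

open MvPolynomial Matrix

/-! The whole proof rests on one idempotent. A polynomial representation of degree `d` has matrix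
coefficients that are homogeneous polynomials of degree `d` (`IsPolynomial.homRep`): the weights
exclude a pole along `det = 0`, and scalar matrices fix the degree. By density of `GL` it therefore
extends to the monoid of all matrices (`HomRep.exists_extension`), where e = diag(1,…,1,0), written
`corner 1`, acts. Letting the parameter of `S` tend to 0 shows that M^S = eM
(`HomRep.mem_invariants_iff`). Moreover e x e is again a corner matrix for every x, so the corner
matrices, a copy of the n × n matrices, govern the action on eM.

Exactness: eM is a natural direct summand of the vector space M.

Weyl modules: the universal property gives θ : Δ(λ) → Δ(λ,0)^S. It is onto because on the dense cell
g = p b the vector e g v is a multiple of a v, with a the upper left block of p. It is injective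
because Δ(λ) is the space of S-invariants of a coinduced module of `GL_{n+1}`, whose highest weight
vector of weight (λ,0) receives a map from Δ(λ,0) and yields a retraction of θ. Submodules avoiding
the highest weight vector can be carried across θ in both directions, which matches the radicals and
gives the statement for L(λ) (`mem_weylRad_iff`).

Equivalence: coinduction makes τ essentially surjective. If d ≤ n, a weight with n+1 nonnegative
entries of sum d has a zero entry, which a permutation moves to the last place; so a nonzero M has
M^S ≠ 0 (`HomRep.subsingleton_of_invariants`). Hence M^S generates M and no nonzero
subrepresentation is killed by e. This gives faithfulness, and fullness follows because the graph of
a map on invariants generates the graph of a map (`exists_extension_of_invariants`). -/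

lemma mvPolynomial_eq_zero_of_dense [Infinite F] {σ : Type*} {P Q : MvPolynomial σ F} (hQ : Q ≠ 0)
    (h : ∀ x, eval x Q ≠ 0 → eval x P = 0) : P = 0 := by
  have : P * Q = 0 := by
    refine MvPolynomial.funext fun x => ?_
    by_cases hx : eval x Q = 0
    · simp [hx]
    · simp [h x hx]
  exact (mul_eq_zero.1 this).resolve_right hQ

lemma eval_det_submatrix_mvPolynomialX {ι κ : Type*} {k : ℕ} (r : Fin k → ι) (c : Fin k → κ)
    (x : ι × κ → F) :
    eval x ((mvPolynomialX ι κ F).submatrix r c).det =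
      (Matrix.of fun i j => x (r i, c j)).det := by
  rw [RingHom.map_det]
  congr 1
  ext i j
  simp [mvPolynomialX]

lemma eval_det_mvPolynomialX {ι : Type*} [Fintype ι] [DecidableEq ι] (x : Matrix ι ι F) :
    eval (fun ij => x ij.1 ij.2) (mvPolynomialX ι ι F).det = x.det := by
  rw [RingHom.map_det]
  congr 1
  ext i j
  simp [mvPolynomialX]

lemma det_mem_supported {ι κ : Type*} {k : ℕ} (r : Fin k → ι) (c : Fin k → κ) (s : Set (ι × κ))
    (h : ∀ i j, (r i, c j) ∈ s) :
    ((mvPolynomialX ι κ F).submatrix r c).det ∈ supported F s := by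
  rw [Matrix.det_apply]
  refine Subalgebra.sum_mem _ fun σ _ => ?_
  rw [Units.smul_def, ← Int.cast_smul_eq_zsmul F]
  refine Subalgebra.smul_mem _ (Subalgebra.prod_mem _ fun i _ => ?_) _
  simp only [submatrix_apply, mvPolynomialX_apply]
  exact Algebra.subset_adjoin ⟨_, h _ _, rfl⟩

/-- Minors of the generic matrix are irreducible. -/
theorem irreducible_det_submatrix {ι κ : Type*} (k : ℕ) (r : Fin (k + 1) → ι)
    (c : Fin (k + 1) → κ) (hr : Function.Injective r) (hc : Function.Injective c) :
    Irreducible ((mvPolynomialX ι κ F).submatrix r c).det := by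
  classical
  induction k with
  | zero =>
    rw [Matrix.det_fin_one]
    exact (MvPolynomial.X_prime (R := F)).irreducible
  | succ k ih =>
    have hM := ih (r ∘ Fin.succ) (c ∘ Fin.succ) (hr.comp (Fin.succ_injective _))
      (hc.comp (Fin.succ_injective _))
    set M := ((mvPolynomialX ι κ F).submatrix (r ∘ Fin.succ) (c ∘ Fin.succ)).det with hMdef
    set N : MvPolynomial (ι × κ) F := ∑ j : Fin (k + 1), (-1) ^ (j.succ : ℕ) *
      X (r 0, c j.succ) * ((mvPolynomialX ι κ F).submatrix (r ∘ Fin.succ)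
        (c ∘ j.succ.succAbove)).det with hN
    have hdet : ((mvPolynomialX ι κ F).submatrix r c).det = M * X (r 0, c 0) + N := by
      rw [Matrix.det_succ_row_zero, Fin.sum_univ_succ]
      congr 1
      simp only [Fin.val_zero, pow_zero, one_mul, submatrix_apply, mvPolynomialX_apply,
        Matrix.submatrix_submatrix, Fin.succAbove_zero]
      rw [mul_comm]
    have hMs : M ∈ supported F {p : ι × κ | p ≠ (r 0, c 0)} :=
      det_mem_supported _ _ _ fun i j h => by
        simpa using hr (Prod.ext_iff.1 h).1
    have hNs : N ∈ supported F {p : ι × κ | p ≠ (r 0, c 0)} := by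
      refine Subalgebra.sum_mem _ fun j _ => Subalgebra.mul_mem _ (Subalgebra.mul_mem _
        (Subalgebra.pow_mem _ (Subalgebra.neg_mem _ (Subalgebra.one_mem _)) _) ?_) ?_
      · exact Algebra.subset_adjoin ⟨_, fun h => by simpa using hc (Prod.ext_iff.1 h).2, rfl⟩
      · exact det_mem_supported _ _ _ fun i j h => by
          simpa using hr (Prod.ext_iff.1 h).1
    rw [hdet]
    refine irreducible_mul_X_add M N _ hM.ne_zero (fun h => mem_supported.1 hMs h rfl)
      (fun h => mem_supported.1 hNs h rfl) (hM.isRelPrime_iff_not_dvd.2 ?_)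
    rintro ⟨Q, hQ⟩
    -- The determinant has degree one in the corner variable with leading coefficient M, so it
    -- remains to exclude M ∣ N. At the permutation matrix of the transposition (0 1) the minor M
    -- vanishes but the determinant does not, whereas M ∣ N would make M divide the determinant.
    let τ : Equiv.Perm (Fin (k + 2)) := Equiv.swap 0 1
    let x : ι × κ → F := fun p => if ∃ i, p = (r i, c (τ i)) then 1 else 0
    have hx : ∀ i j, x (r i, c j) = if j = τ i then 1 else 0 := fun i j => by
      have : (∃ i', (r i, c j) = (r i', c (τ i'))) ↔ j = τ i := by
        constructor
        · rintro ⟨i', h⟩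
          obtain ⟨h1, h2⟩ := Prod.ext_iff.1 h
          rw [hc h2, hr h1]
        · rintro rfl
          exact ⟨i, rfl⟩
      by_cases h : j = τ i
      · exact (if_pos (this.2 h)).trans (if_pos h).symm
      · exact (if_neg (mt this.1 h)).trans (if_neg h).symm
    have h1 : eval x M = 0 := by
      rw [hMdef, eval_det_submatrix_mvPolynomialX]
      refine Matrix.det_eq_zero_of_row_eq_zero 0 fun j => ?_
      have : ¬ j.succ = τ (Fin.succ 0) := by simp [τ, Fin.succ_ne_zero]
      simp only [of_apply, Function.comp_apply, hx, if_neg this]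
    have h2 : eval x ((mvPolynomialX ι κ F).submatrix r c).det ≠ 0 := by
      rw [eval_det_submatrix_mvPolynomialX]
      have : (Matrix.of fun i j => x (r i, c j)) = (τ.permMatrix F) := by
        ext i j
        simp [hx, Equiv.Perm.permMatrix, PEquiv.toMatrix_apply, Equiv.toPEquiv_apply, eq_comm]
      rw [this, Matrix.det_permutation]
      rcases Int.units_eq_one_or (Equiv.Perm.sign τ) with h | h <;> simp [h]
    apply h2
    rw [hdet, hQ]
    simp [h1]

/-- By the Nullstellensatz a power of `P` is divisible by the generic determinant, which is
irreducible and hence prime. -/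
lemma det_dvd_of_vanish [IsAlgClosed F] {n : ℕ} (P : MvPolynomial (Fin (n + 1) × Fin (n + 1)) F)
    (h : ∀ x : Matrix (Fin (n + 1)) (Fin (n + 1)) F, x.det = 0 →
      eval (fun ij => x ij.1 ij.2) P = 0) :
    (mvPolynomialX (Fin (n + 1)) (Fin (n + 1)) F).det ∣ P := by
  have hirr := irreducible_det_submatrix (F := F) n (id : Fin (n + 1) → _) (id : Fin (n + 1) → _)
    Function.injective_id Function.injective_id
  rw [Matrix.submatrix_id_id] at hirr
  have hP : P ∈ vanishingIdeal F (zeroLocus F (Ideal.span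
      {(mvPolynomialX (Fin (n + 1)) (Fin (n + 1)) F).det})) := by
    rw [mem_vanishingIdeal_iff]
    intro x hx
    rw [mem_zeroLocus_iff] at hx
    have h1 := hx _ (Ideal.subset_span rfl)
    change eval x _ = 0 at h1
    change eval x P = 0
    have h2 := eval_det_mvPolynomialX (F := F) (Matrix.of fun i j => x (i, j))
    refine h (Matrix.of fun i j => x (i, j)) ?_
    rw [← h2]
    exact h1
  rw [vanishingIdeal_zeroLocus_eq_radical, Ideal.mem_radical_iff] at hP
  obtain ⟨k, hk⟩ := hP
  exact hirr.prime.dvd_of_dvd_pow (Ideal.mem_span_singleton.1 hk)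

/-- The space of homogeneous polynomial functions of degree `d` on matrices. -/
def homFun (F : Type u) [Field F] (ι κ : Type*) (d : ℕ) : Submodule F (Matrix ι κ F → F) :=
  (homogeneousSubmodule (ι × κ) F d).map
    ({ toFun := fun P x => eval (fun ij => x ij.1 ij.2) P
       map_add' := fun P Q => by ext; simp
       map_smul' := fun c P => by ext; simp [smul_eval] } :
      MvPolynomial (ι × κ) F →ₗ[F] (Matrix ι κ F → F))

variable {ι κ ι' κ' : Type*} {d : ℕ}

lemma mem_homFun {f : Matrix ι κ F → F} : f ∈ homFun F ι κ d ↔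
    ∃ P : MvPolynomial (ι × κ) F, P.IsHomogeneous d ∧
      ∀ x, f x = eval (fun ij => x ij.1 ij.2) P := by
  constructor
  · intro hf
    obtain ⟨P, hP, rfl⟩ := Submodule.mem_map.1 hf
    exact ⟨P, hP, fun x => rfl⟩
  · rintro ⟨P, hP, h⟩
    exact Submodule.mem_map.2 ⟨P, hP, funext fun x => (h x).symm⟩

instance [Finite ι] [Finite κ] : Module.Finite F (homFun F ι κ d) := by
  have : Module.Finite F (homogeneousSubmodule (ι × κ) F d) :=
    Module.Finite.iff_fg.2 (homogeneousSubmodule_fg _ _ d)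
  unfold homFun
  infer_instance

lemma homFun_comp_linear [Finite ι] [Finite κ] {f : Matrix ι' κ' F → F} (hf : f ∈ homFun F ι' κ' d)
    (L : Matrix ι κ F →ₗ[F] Matrix ι' κ' F) : (fun x => f (L x)) ∈ homFun F ι κ d := by
  classical
  cases nonempty_fintype ι
  cases nonempty_fintype κ
  obtain ⟨P, hP, h⟩ := mem_homFun.1 hf
  let g : ι' × κ' → MvPolynomial (ι × κ) F := fun ij =>
    ∑ kl : ι × κ, C (L (Matrix.single kl.1 kl.2 1) ij.1 ij.2) * X kl
  refine mem_homFun.2 ⟨aeval g P, ?_, fun x => ?_⟩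
  · have := hP.aeval g (n := 1) fun ij => IsHomogeneous.sum _ _ _ fun kl _ => by
      simpa using (isHomogeneous_C _ _).mul (isHomogeneous_X F kl)
    simpa using this
  · rw [h]
    have hb : eval (fun ij => x ij.1 ij.2) (aeval g P) =
        eval (fun ij => eval (fun ij => x ij.1 ij.2) (g ij)) P :=
      MvPolynomial.eval₂Hom_bind₁ (RingHom.id F) _ g P
    rw [hb]
    congr 2
    funext ij
    have hx : x = ∑ kl : ι × κ, x kl.1 kl.2 • Matrix.single kl.1 kl.2 (1 : F) := by
      rw [Fintype.sum_prod_type]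
      conv_lhs => rw [Matrix.matrix_eq_sum_single x]
      simp [Matrix.smul_single]
    conv_lhs => rw [hx]
    simp [-Matrix.smul_single, g, map_sum, Matrix.sum_apply, mul_comm]

lemma homFun_comp_mul_right {n : ℕ} {m : Type*} [Finite m]
    {f : Matrix m κ F → F} [Finite κ] (hf : f ∈ homFun F m κ d)
    (y : Matrix (Fin n) κ F) : (fun x : Matrix m (Fin n) F => f (x * y)) ∈ homFun F m (Fin n) d :=
  homFun_comp_linear hf
    { toFun := fun x => x * y
      map_add' := fun a b => Matrix.add_mul a b y
      map_smul' := fun c a => Matrix.smul_mul c a y }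

lemma homFun_comp_mul_left {n : ℕ} {m : Type*} [Finite m]
    {f : Matrix m κ F → F} [Finite κ] (hf : f ∈ homFun F m κ d)
    (y : Matrix m (Fin n) F) : (fun x : Matrix (Fin n) κ F => f (y * x)) ∈ homFun F (Fin n) κ d :=
  homFun_comp_linear hf
    { toFun := fun x => y * x
      map_add' := fun a b => Matrix.mul_add y a b
      map_smul' := fun c a => Matrix.mul_smul y c a }

/-- Restriction of a polynomial function to a line. -/
lemma eval_line (P : MvPolynomial (ι × κ) F) (A B : Matrix ι κ F) :
    ∃ q : Polynomial F, ∀ s : F, q.eval s = eval (fun ij => A ij.1 ij.2 + s * B ij.1 ij.2) P := by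
  refine ⟨aeval (fun ij : ι × κ => Polynomial.C (A ij.1 ij.2) +
    Polynomial.X * Polynomial.C (B ij.1 ij.2)) P, fun s => ?_⟩
  rw [← Polynomial.coe_evalRingHom, MvPolynomial.map_aeval]
  simp only [Polynomial.coe_evalRingHom, Polynomial.eval_add, Polynomial.eval_mul,
    Polynomial.eval_C, Polynomial.eval_X]
  have : (Polynomial.evalRingHom s).comp (algebraMap F (Polynomial F)) = RingHom.id F := by
    ext; simp
  rw [this]; rfl

variable {n : ℕ}

lemma polynomial_eq_zero_of_GL [Infinite F] {P : MvPolynomial (Fin n × Fin n) F}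
    (h : ∀ g : GL (Fin n) F, eval (fun ij => g.val ij.1 ij.2) P = 0) : P = 0 := by
  refine mvPolynomial_eq_zero_of_dense (Matrix.det_mvPolynomialX_ne_zero (Fin n) F) fun x hx => ?_
  have h1 := eval_det_mvPolynomialX (F := F) (Matrix.of fun i j => x (i, j))
  have h2 : (Matrix.of fun i j => x (i, j)).det ≠ 0 := by rwa [← h1]
  exact h (Matrix.GeneralLinearGroup.mkOfDetNeZero _ h2)

lemma homFun_eq_of_GL [Infinite F] {f f' : Matrix (Fin n) (Fin n) F → F} {d' : ℕ}
    (hf : f ∈ homFun F (Fin n) (Fin n) d) (hf' : f' ∈ homFun F (Fin n) (Fin n) d')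
    (h : ∀ g : GL (Fin n) F, f g.val = f' g.val) : f = f' := by
  obtain ⟨P, -, hP⟩ := mem_homFun.1 hf
  obtain ⟨Q, -, hQ⟩ := mem_homFun.1 hf'
  have : P - Q = 0 := polynomial_eq_zero_of_GL fun g => by
    rw [map_sub, ← hP, ← hQ, h, sub_self]
  ext x
  rw [hP, hQ, sub_eq_zero.1 this]

end Polynomials

/-! ### Polynomial representations have homogeneous polynomial matrix coefficients -/

section Torus

open MvPolynomial

lemma degree_eq_weight_one' {σ : Type*} (m : σ →₀ ℕ) :
    m.degree = Finsupp.weight (1 : σ → ℕ) m :=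
  DFunLike.congr_fun (Finsupp.degree_eq_weight_one (R := ℕ)) m

lemma eval_smul_of_isHomogeneous {σ : Type*} [Fintype σ] {d : ℕ} {P : MvPolynomial σ F}
    (hP : P.IsHomogeneous d) (c : F) (x : σ → F) :
    eval (fun i => c * x i) P = c ^ d * eval x P := by
  rw [eval_eq', eval_eq', Finset.mul_sum]
  refine Finset.sum_congr rfl fun m hm => ?_
  have h := hP (mem_support_iff.1 hm)
  rw [← degree_eq_weight_one' m, Finsupp.degree_eq_sum] at h
  simp_rw [mul_pow, Finset.prod_mul_distrib, Finset.prod_pow_eq_pow_sum, h]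
  ring

lemma polynomial_eq_of_units [Infinite F] {p q : Polynomial F}
    (h : ∀ s : Fˣ, p.eval (s : F) = q.eval (s : F)) : p = q := by
  refine Polynomial.eq_of_infinite_eval_eq p q ?_
  refine ((Set.finite_singleton (0 : F)).infinite_compl).mono fun s hs => ?_
  exact h (Units.mk0 s hs)

lemma mvPolynomial_eq_zero_of_units [Infinite F] {σ : Type*} [Fintype σ] {P : MvPolynomial σ F}
    (h : ∀ t : σ → Fˣ, eval (fun i => (t i : F)) P = 0) : P = 0 := by
  refine mvPolynomial_eq_zero_of_dense (Q := ∏ i, X i)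
    (Finset.prod_ne_zero_iff.2 fun i _ => X_ne_zero i) fun x hx => ?_
  have hx' : ∀ i, x i ≠ 0 := fun i hi => hx (by
    rw [map_prod]; exact Finset.prod_eq_zero (Finset.mem_univ i) (by simpa using hi))
  exact h fun i => Units.mk0 (x i) (hx' i)

lemma prod_zpow_eq_zpow_sum {σ : Type*} [Fintype σ] (s : Fˣ) (μ : σ → ℤ) :
    ∏ i, (s : F) ^ μ i = (s : F) ^ ∑ i, μ i := by
  have h : ∏ i, s ^ μ i = s ^ ∑ i, μ i := by
    classical
    induction (Finset.univ : Finset σ) using Finset.induction_on with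
    | empty => simp
    | insert i t hi ih => rw [Finset.prod_insert hi, Finset.sum_insert hi, zpow_add, ih]
  simpa using congrArg Units.val h

/-- For negative `k`, clearing the denominator gives X^(-k) q = c, and evaluation at 0 contradicts c
≠ 0. -/
lemma nonneg_of_zpow_mul_eq_eval [Infinite F] {k : ℤ} {c : F} (hc : c ≠ 0) (q : Polynomial F)
    (h : ∀ s : Fˣ, (s : F) ^ k * c = q.eval (s : F)) : 0 ≤ k := by
  by_contra hk
  obtain ⟨j, hj⟩ : ∃ j : ℕ, k = -(j + 1 : ℕ) := ⟨(-k - 1).toNat, by omega⟩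
  have h1 : Polynomial.X ^ (j + 1) * q = Polynomial.C c := polynomial_eq_of_units fun s => by
    rw [Polynomial.eval_mul, ← h s, hj]
    rw [zpow_neg, zpow_natCast, Polynomial.eval_pow, Polynomial.eval_X, ← mul_assoc,
      mul_inv_cancel₀ (pow_ne_zero _ s.ne_zero), one_mul, Polynomial.eval_C]
  have h2 := congrArg (Polynomial.eval 0) h1
  simp at h2
  exact hc h2.symm

lemma eq_of_zpow_eq_zpow [Infinite F] {k l : ℤ} (h : ∀ s : Fˣ, (s : F) ^ k = (s : F) ^ l) :
    k = l := by
  have key : ∀ k l : ℤ, (∀ s : Fˣ, (s : F) ^ k = (s : F) ^ l) → l ≤ k := fun k l h => by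
    have := nonneg_of_zpow_mul_eq_eval (k := k - l) (one_ne_zero (α := F)) 1 fun s => by
      rw [zpow_sub₀ s.ne_zero, h s]
      rw [div_self (zpow_ne_zero _ s.ne_zero)]; simp
    omega
  exact le_antisymm (key l k fun s => (h s).symm) (key k l h)

variable {n : ℕ} {V : Type*} [AddCommGroup V] [Module F V]

lemma diag_mul (t t' : Fin n → Fˣ) : diag (t * t') = diag t * diag t' := by
  apply Units.ext
  simp [diag, Matrix.diagonal_mul_diagonal]

lemma diag_one : diag (1 : Fin n → Fˣ) = 1 := by
  apply Units.ext
  simp [diag]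

/-- A rational representation is spanned by weight vectors. -/
theorem iSup_weightSpace [Infinite F] {ρ : Representation F (GL (Fin n) F) V}
    (h : IsRational ρ) : ⨆ μ, weightSpace ρ μ = ⊤ := by
  classical
  have := h.finite
  refine eq_top_iff.2 fun v _ => ?_
  let b := Module.finBasis F V
  choose P k hPk using fun i => h.coeff (b.coord i) v
  let K := ∑ i, k i
  have hK : ∀ i, k i ≤ K := fun i => Finset.single_le_sum (fun _ _ => Nat.zero_le _)
    (Finset.mem_univ i)
  -- Multiplication by det^K clears all poles at once: `Q i` is the i-th coordinate of det(t)^K ·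
  -- diag(t) v as a polynomial in t, and `w m` below collects its coefficients at the monomial m
  -- into a vector.
  let Q : Fin (Module.finrank F V) → MvPolynomial (Fin n) F := fun i =>
    bind₁ (fun ij : Fin n × Fin n => if ij.1 = ij.2 then X ij.1 else 0) (P i) *
      (∏ j, X j) ^ (K - k i)
  have hQ : ∀ i (t : Fin n → Fˣ), (∏ j, (t j : F)) ^ K * b.coord i (ρ (diag t) v) =
      eval (fun j => (t j : F)) (Q i) := fun i t => by
    have h0 : (∏ j, (t j : F)) ≠ 0 := Finset.prod_ne_zero_iff.2 fun j _ => (t j).ne_zero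
    have hb : eval (fun j => (t j : F)) (bind₁ (fun ij : Fin n × Fin n =>
        if ij.1 = ij.2 then X ij.1 else 0) (P i)) =
        eval (fun ij => (diag t).val ij.1 ij.2) (P i) := by
      refine (MvPolynomial.eval₂Hom_bind₁ (RingHom.id F) _ _ _).trans ?_
      change MvPolynomial.eval _ _ = _
      congr 2
      funext ij
      by_cases hij : ij.1 = ij.2
      · simp [hij, diag]
      · simp [hij, diag]
    have hd : (diag t).val.det = ∏ j, (t j : F) := by simp [diag]
    rw [hPk, hd]
    simp only [Q, map_mul, hb, map_pow, map_prod, eval_X]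
    have : (∏ j, (t j : F)) ^ K = (∏ j, (t j : F)) ^ (K - k i) * (∏ j, (t j : F)) ^ k i := by
      rw [← pow_add, Nat.sub_add_cancel (hK i)]
    rw [this]
    field_simp
  let S : Finset (Fin n →₀ ℕ) := Finset.univ.biUnion fun i => (Q i).support
  let w : (Fin n →₀ ℕ) → V := fun m => ∑ i, (Q i).coeff m • b i
  have hw : ∀ t : Fin n → Fˣ, (∏ j, (t j : F)) ^ K • ρ (diag t) v =
      ∑ m ∈ S, (∏ j, (t j : F) ^ m j) • w m := fun t => by
    apply b.ext_elem
    intro i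
    have h1 := hQ i t
    rw [Module.Basis.coord_apply] at h1
    rw [map_smul, Finsupp.smul_apply, smul_eq_mul, h1, eval_eq']
    rw [Finset.sum_subset (Finset.subset_biUnion_of_mem (fun i => (Q i).support)
      (Finset.mem_univ i)) fun m _ hm => by rw [notMem_support_iff.1 hm, zero_mul]]
    simp only [w, map_sum, map_smul, Finsupp.coe_finsetSum, Finset.sum_apply, Finsupp.smul_apply,
      smul_eq_mul, Module.Basis.repr_self]
    refine Finset.sum_congr rfl fun m _ => ?_
    rw [Finset.sum_eq_single i (fun j _ hj => by simp [hj]) (by simp)]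
    simp [mul_comm]
  have hv : v = ∑ m ∈ S, w m := by
    have := hw 1
    simpa [diag_one] using this
  rw [hv]
  -- The shift by `K` undoes the factor det^K. That `w m` has this weight follows by fixing t' and
  -- comparing the coefficients of t^m in diag(t') diag(t) v = diag(t' t) v.
  refine Submodule.sum_mem _ fun m hm => Submodule.mem_iSup_of_mem (fun j => (m j : ℤ) - K) ?_
  intro t'
  rw [← sub_eq_zero, ← Module.forall_dual_apply_eq_zero_iff F]
  intro φ
  let c : (Fin n →₀ ℕ) → F := fun m => ∏ j, (t' j : F) ^ ((m j : ℤ) - K)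
  have hR : (∑ m ∈ S, monomial m (φ (ρ (diag t') (w m) - c m • w m))) = 0 := by
    refine mvPolynomial_eq_zero_of_units fun t => ?_
    have e1 : ∑ m ∈ S, (∏ j, (t j : F) ^ m j) • ρ (diag t') (w m) =
        (∏ j, (t j : F)) ^ K • ρ (diag (t' * t)) v := by
      rw [diag_mul, map_mul, Module.End.mul_apply, ← map_smul, hw, map_sum]
      simp_rw [map_smul]
    have e2 : ∑ m ∈ S, (∏ j, (t j : F) ^ m j) • c m • w m =
        (∏ j, (t j : F)) ^ K • ρ (diag (t' * t)) v := by
      have h0 : (∏ j, (t' j : F)) ^ K ≠ 0 :=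
        pow_ne_zero _ (Finset.prod_ne_zero_iff.2 fun j _ => (t' j).ne_zero)
      have e3 := hw (t' * t)
      simp only [Pi.mul_apply, Units.val_mul, Finset.prod_mul_distrib, mul_pow] at e3
      rw [mul_smul] at e3
      rw [← (smul_right_injective V h0).eq_iff]
      rw [e3, Finset.smul_sum]
      refine Finset.sum_congr rfl fun m _ => ?_
      simp only [smul_smul]
      congr 1
      have : c m = (∏ j, (t' j : F) ^ m j) * ((∏ j, (t' j : F)) ^ K)⁻¹ := by
        simp only [c, ← Finset.prod_pow, ← Finset.prod_inv_distrib, ← Finset.prod_mul_distrib]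
        refine Finset.prod_congr rfl fun j _ => ?_
        rw [zpow_sub₀ (t' j).ne_zero]
        simp [div_eq_mul_inv]
      rw [this]
      field_simp
    rw [map_sum]
    have e4 := congrArg φ (e1.trans e2.symm)
    rw [← sub_eq_zero, ← map_sub, ← Finset.sum_sub_distrib, map_sum] at e4
    rw [← e4]
    refine Finset.sum_congr rfl fun m _ => ?_
    rw [← smul_sub, map_smul, eval_monomial, smul_eq_mul, mul_comm, Finsupp.prod_fintype _ _ (by simp)]
  have := congrArg (coeff m) hR
  rw [coeff_sum, Finset.sum_eq_single m (fun m' _ h => by simp [coeff_monomial, h])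
    (fun h => (h hm).elim), coeff_monomial, if_pos rfl, coeff_zero] at this
  exact this

lemma IsRational.weight_induction [Infinite F] {ρ : Representation F (GL (Fin n) F) V}
    (h : IsRational ρ) {motive : V → Prop} (v : V)
    (mem : ∀ μ, ∀ v ∈ weightSpace ρ μ, motive v) (zero : motive 0)
    (add : ∀ v w, motive v → motive w → motive (v + w)) : motive v :=
  Submodule.iSup_induction (motive := motive) (weightSpace ρ)
    (by rw [iSup_weightSpace h]; trivial) mem zero add

/-- Representations whose matrix coefficients are homogeneous polynomials of degree `d`. -/
structure HomRep (d : ℕ) (ρ : Representation F (GL (Fin n) F) V) : Prop where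
  finite : Module.Finite F V
  coeff : ∀ (φ : Module.Dual F V) (v : V),
    ∃ f ∈ homFun F (Fin n) (Fin n) d, ∀ g : GL (Fin n) F, φ (ρ g v) = f g.val

lemma HomRep.isPolynomial [Infinite F] {d : ℕ} {ρ : Representation F (GL (Fin n) F) V}
    (h : HomRep d ρ) : IsPolynomial d ρ := by
  classical
  have := h.finite
  refine ⟨⟨h.finite, fun φ v => ?_⟩, fun μ hμ => ?_⟩
  · obtain ⟨f, hf, hfg⟩ := h.coeff φ v
    obtain ⟨P, -, hP⟩ := mem_homFun.1 hf
    exact ⟨P, 0, fun g => by rw [hfg, hP]; simp⟩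
  · obtain ⟨v, hv, hv0⟩ := (Submodule.ne_bot_iff _).1 hμ
    obtain ⟨φ, hφ⟩ : ∃ φ : Module.Dual F V, φ v ≠ 0 := by
      by_contra! hc
      exact hv0 ((Module.forall_dual_apply_eq_zero_iff F v).1 hc)
    obtain ⟨f, hf, hfg⟩ := h.coeff φ v
    obtain ⟨P, hP0, hP⟩ := mem_homFun.1 hf
    have key : ∀ t : Fin n → Fˣ, (∏ i, (t i : F) ^ μ i) * φ v =
        eval (fun ij => (diag t).val ij.1 ij.2) P := fun t => by
      rw [← hP, ← hfg, hv t, map_smul, smul_eq_mul]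
    constructor
    · intro i
      -- On the line diag(1,…,s,…,1) the coefficient equals s^(μ i) φ(v) and is polynomial in s.
      obtain ⟨q, hq⟩ := eval_line P (Matrix.diagonal fun j => if j = i then (0 : F) else 1)
        (Matrix.diagonal fun j => if j = i then (1 : F) else 0)
      refine nonneg_of_zpow_mul_eq_eval hφ q fun s => ?_
      have := key (fun j => if j = i then s else 1)
      rw [hq]
      convert this using 2
      · rw [Finset.prod_eq_single i (fun j _ hj => by simp [hj]) (by simp)]
        simp
      · congr 1
        funext ij
        by_cases h1 : ij.1 = ij.2
        · by_cases h2 : ij.2 = i <;> simp [diag, h1, h2]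
        · simp [diag, Matrix.diagonal_apply_ne _ h1]
    · apply eq_of_zpow_eq_zpow (F := F)
      intro s
      have h1 := key (fun _ => s)
      have h2 := key (fun _ => 1)
      have h3 : (fun ij : Fin n × Fin n => (diag fun _ => s).val ij.1 ij.2) =
          fun ij => (s : F) * (diag fun _ => 1).val ij.1 ij.2 := by
        funext ij
        by_cases h1 : ij.1 = ij.2
        · simp [diag, h1]
        · simp [diag, Matrix.diagonal_apply_ne _ h1, Matrix.one_apply_ne h1]
      rw [h3, eval_smul_of_isHomogeneous hP0, ← h2] at h1
      have h4 : (∏ i, (s : F) ^ μ i) = (s : F) ^ ∑ i, μ i := by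
        exact prod_zpow_eq_zpow_sum s μ
      rw [h4] at h1
      simp only [Units.val_one, one_zpow, Finset.prod_const_one, one_mul] at h1
      simpa using mul_right_cancel₀ hφ h1

variable {d : ℕ} {ρ : Representation F (GL (Fin n) F) V}

/-- Matrix coefficients of a polynomial representation are polynomial on the torus. -/
lemma IsPolynomial.torus_coeff [Infinite F] (h : IsPolynomial d ρ) (φ : Module.Dual F V) (v : V) :
    ∃ Q : MvPolynomial (Fin n) F, ∀ t : Fin n → Fˣ,
      φ (ρ (diag t) v) = eval (fun i => (t i : F)) Q := by
  classical
  induction v using h.rational.weight_induction with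
  | mem μ v hv =>
    by_cases hv0 : v = 0
    · exact ⟨0, fun t => by simp [hv0]⟩
    · have hμ := (h.weights μ ((Submodule.ne_bot_iff _).2 ⟨v, hv, hv0⟩)).1
      refine ⟨C (φ v) * ∏ i, X i ^ (μ i).toNat, fun t => ?_⟩
      rw [hv t, map_smul, smul_eq_mul, map_mul, eval_C, mul_comm, map_prod]
      congr 1
      refine Finset.prod_congr rfl fun i _ => ?_
      rw [map_pow, eval_X, ← zpow_natCast, Int.toNat_of_nonneg (hμ i)]
  | zero => exact ⟨0, fun t => by simp⟩
  | add v w hv hw =>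
    obtain ⟨Q, hQ⟩ := hv
    obtain ⟨Q', hQ'⟩ := hw
    exact ⟨Q + Q', fun t => by simp [hQ, hQ']⟩

lemma IsPolynomial.scalar [Infinite F] (h : IsPolynomial d ρ) (c : Fˣ) (v : V) :
    ρ (diag fun _ => c) v = (c : F) ^ d • v := by
  induction v using h.rational.weight_induction with
  | mem μ v hv =>
    by_cases hv0 : v = 0
    · simp [hv0]
    · have hμ := (h.weights μ ((Submodule.ne_bot_iff _).2 ⟨v, hv, hv0⟩)).2
      rw [hv, prod_zpow_eq_zpow_sum, hμ, zpow_natCast]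
  | zero => simp
  | add v w hv hw => rw [map_add, hv, hw, smul_add]

/-- Reduces questions about singular matrices to diagonal ones, where the weights give control. -/
lemma exists_GL_mul_diagonal_mul_GL (x : Matrix (Fin n) (Fin n) F) :
    ∃ (g h : GL (Fin n) F) (D : Fin n → F), x = g.val * Matrix.diagonal D * h.val := by
  obtain ⟨L, L', D, hx⟩ :=
    Matrix.Pivot.exists_list_transvec_mul_diagonal_mul_list_transvec x
  have hL : ∀ L : List (Matrix.TransvectionStruct (Fin n) F),
      (L.map Matrix.TransvectionStruct.toMatrix).prod.det ≠ 0 := fun L => by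
    rw [Matrix.TransvectionStruct.det_toMatrix_prod]; exact one_ne_zero
  exact ⟨Matrix.GeneralLinearGroup.mkOfDetNeZero _ (hL L),
    Matrix.GeneralLinearGroup.mkOfDetNeZero _ (hL L'), D, hx⟩

/-- The numerator of a matrix coefficient with a pole along `det = 0` vanishes on singular
matrices, if the representation is polynomial. -/
lemma IsPolynomial.numerator_vanish [Infinite F] (h : IsPolynomial d ρ) (φ : Module.Dual F V)
    (v : V) {P : MvPolynomial (Fin n × Fin n) F} {k : ℕ}
    (hP : ∀ g : GL (Fin n) F,
      φ (ρ g v) = eval (fun ij => g.val ij.1 ij.2) P * (g.val.det ^ (k + 1))⁻¹)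
    (x : Matrix (Fin n) (Fin n) F) (hx : x.det = 0) : eval (fun ij => x ij.1 ij.2) P = 0 := by
  classical
  obtain ⟨g, g', D, rfl⟩ := exists_GL_mul_diagonal_mul_GL x
  have hg : g.val.det ≠ 0 := g.isUnit.map (Matrix.detMonoidHom) |>.ne_zero
  have hg' : g'.val.det ≠ 0 := g'.isUnit.map (Matrix.detMonoidHom) |>.ne_zero
  have hD : ∏ i, D i = 0 := by
    simpa [Matrix.det_mul, hg, hg', Matrix.det_diagonal] using hx
  obtain ⟨Q, hQ⟩ := h.torus_coeff (φ ∘ₗ ρ g) (ρ g' v)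
  let P' : MvPolynomial (Fin n) F := bind₁ (fun ij : Fin n × Fin n =>
    ∑ l, C (g.val ij.1 l) * X l * C (g'.val l ij.2)) P
  have hP' : ∀ t : Fin n → F, eval t P' =
      eval (fun ij => (g.val * Matrix.diagonal t * g'.val) ij.1 ij.2) P := fun t => by
    refine (MvPolynomial.eval₂Hom_bind₁ (RingHom.id F) _ _ _).trans ?_
    change MvPolynomial.eval _ _ = _
    congr 2
    funext ij
    change MvPolynomial.eval t _ = _
    rw [Matrix.mul_apply]
    simp [Matrix.mul_diagonal]
  -- The matrix coefficient is a genuine polynomial Q on the torus, so P restricted to g · diag · g'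
  -- is Q times a positive power of the determinant. The identity extends from units to `D`, where
  -- the determinant factor is zero.
  have key : P' - C (g.val.det ^ (k + 1) * g'.val.det ^ (k + 1)) *
      (∏ i, X i) ^ (k + 1) * Q = 0 := mvPolynomial_eq_zero_of_units fun t => by
    have h1 := hP (g * diag t * g')
    have h2 := hQ t
    have ht : (diag t).val.det = ∏ i, (t i : F) := by simp [diag]
    have h0 : ∏ i, (t i : F) ≠ 0 := Finset.prod_ne_zero_iff.2 fun j _ => (t j).ne_zero
    simp only [map_mul, Module.End.mul_apply, Units.val_mul, Matrix.det_mul, ht] at h1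
    rw [LinearMap.comp_apply, h1] at h2
    simp only [map_sub, map_mul, map_pow, map_prod, eval_X, eval_C, hP', ← h2]
    rw [sub_eq_zero]
    change eval (fun ij => (g.val * (diag t).val * g'.val) ij.1 ij.2) P = _
    field_simp
    ring
  have := congrArg (eval D) key
  simpa [hP', hD] using this

/-- The pole order drops by one at a time, since the numerator vanishes on singular matrices and is
thus divisible by the determinant. Size 0 is separate: there the determinant is 1 and not
irreducible. -/
lemma IsPolynomial.coeff_polynomial [IsAlgClosed F] (h : IsPolynomial d ρ) (φ : Module.Dual F V)
    (v : V) : ∃ P : MvPolynomial (Fin n × Fin n) F, ∀ g : GL (Fin n) F,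
      φ (ρ g v) = eval (fun ij => g.val ij.1 ij.2) P := by
  have : Infinite F := IsAlgClosed.instInfinite
  obtain ⟨P, k, hP⟩ := h.rational.coeff φ v
  cases n with
  | zero => exact ⟨P, fun g => by rw [hP]; simp⟩
  | succ n =>
    induction k generalizing P with
    | zero => exact ⟨P, fun g => by rw [hP]; simp⟩
    | succ k ih =>
      obtain ⟨Q, rfl⟩ := det_dvd_of_vanish P (h.numerator_vanish φ v hP)
      refine ih Q fun g => ?_
      have hg : g.val.det ≠ 0 := g.isUnit.map (Matrix.detMonoidHom) |>.ne_zero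
      rw [hP, map_mul, eval_det_mvPolynomialX, pow_succ]
      field_simp

theorem IsPolynomial.homRep [IsAlgClosed F] (h : IsPolynomial d ρ) : HomRep d ρ := by
  have : Infinite F := IsAlgClosed.instInfinite
  refine ⟨h.rational.finite, fun φ v => ?_⟩
  obtain ⟨P, hP⟩ := h.coeff_polynomial φ v
  refine ⟨_, mem_homFun.2 ⟨homogeneousComponent d P, homogeneousComponent_isHomogeneous d P,
    fun x => rfl⟩, fun g => ?_⟩
  let x : Fin n × Fin n → F := fun ij => g.val ij.1 ij.2
  let q : Polynomial F := ∑ j ∈ Finset.range (P.totalDegree + 1),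
    Polynomial.C (eval x (homogeneousComponent j P)) * Polynomial.X ^ j
  -- The scalar matrix s acts by s^d, so P(s g) = s^d P(g); comparing coefficients of s^d leaves
  -- only the component of degree d.
  have hq : q = Polynomial.C (eval x P) * Polynomial.X ^ d := polynomial_eq_of_units fun s => by
    have h1 := hP (g * diag fun _ => s)
    rw [map_mul, Module.End.mul_apply, h.scalar, map_smul, map_smul, smul_eq_mul, hP] at h1
    have h2 : (fun ij : Fin n × Fin n => (g * diag fun _ => s).val ij.1 ij.2) =
        fun ij => (s : F) * x ij := by
      funext ij
      simp [diag, Matrix.mul_diagonal, x, mul_comm]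
    rw [h2] at h1
    simp only [Polynomial.eval_mul, Polynomial.eval_C, Polynomial.eval_pow, Polynomial.eval_X, q,
      Polynomial.eval_finsetSum]
    rw [mul_comm, h1]
    conv_rhs => rw [← sum_homogeneousComponent P]
    rw [map_sum]
    refine Finset.sum_congr rfl fun j _ => ?_
    rw [eval_smul_of_isHomogeneous (homogeneousComponent_isHomogeneous j P), mul_comm]
  rw [hP]
  have h3 := congrArg (Polynomial.coeff · d) hq
  simp only [q, Polynomial.finsetSum_coeff, Polynomial.coeff_C_mul_X_pow] at h3
  rw [if_true] at h3
  change eval x P = eval x _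
  rw [← h3]
  by_cases hd : d ∈ Finset.range (P.totalDegree + 1)
  · rw [Finset.sum_eq_single d (fun j _ hj => if_neg hj.symm) (fun h => (h hd).elim), if_pos rfl]
  · rw [homogeneousComponent_eq_zero _ _ (by simpa [Nat.lt_succ_iff] using hd), map_zero]
    exact Finset.sum_eq_zero fun j hj => if_neg fun hdj => hd (by rwa [hdj])

end Torus

/-! ### Closure properties and the extension to the monoid of all matrices -/

section Closure

variable {n d : ℕ} {V : Type*} [AddCommGroup V] [Module F V]
  {ρ : Representation F (GL (Fin n) F) V}

/-- The functionals with homogeneous coefficients form a subspace of the dual, and in finite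
dimension a subspace that separates points is the whole dual. -/
lemma HomRep.of_separating (hV : Module.Finite F V) (S : Set (Module.Dual F V))
    (hS : ∀ v, (∀ φ ∈ S, φ v = 0) → v = 0)
    (h : ∀ φ ∈ S, ∀ v, ∃ f ∈ homFun F (Fin n) (Fin n) d, ∀ g : GL (Fin n) F,
      φ (ρ g v) = f g.val) : HomRep d ρ := by
  refine ⟨hV, ?_⟩
  let D : Subspace F (Module.Dual F V) :=
    { carrier := {φ | ∀ v, ∃ f ∈ homFun F (Fin n) (Fin n) d, ∀ g : GL (Fin n) F,
        φ (ρ g v) = f g.val}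
      add_mem' := fun ha hb v => by
        obtain ⟨f, hf, hfg⟩ := ha v
        obtain ⟨f', hf', hfg'⟩ := hb v
        exact ⟨f + f', add_mem hf hf', fun g => by simp [hfg, hfg']⟩
      zero_mem' := fun v => ⟨0, zero_mem _, fun g => by simp⟩
      smul_mem' := fun c φ ha v => by
        obtain ⟨f, hf, hfg⟩ := ha v
        exact ⟨c • f, Submodule.smul_mem _ _ hf, fun g => by simp [hfg]⟩ }
  have hD : D.dualCoannihilator = ⊥ := by
    refine (Submodule.eq_bot_iff _).2 fun v hv => hS v fun φ hφ => ?_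
    exact (Submodule.mem_dualCoannihilator v).1 hv φ (h φ hφ)
  have hD' : D = ⊤ := by
    rw [← Subspace.dualCoannihilator_dualAnnihilator_eq (W := D), hD,
      Submodule.dualAnnihilator_bot]
  intro φ
  have : φ ∈ D := hD' ▸ Submodule.mem_top
  exact this

/-- A representation that embeds into a finite family of polynomial representations. -/
lemma HomRep.of_jointly_injective {J : Type*} [Finite J] {W : J → Type*}
    [∀ j, AddCommGroup (W j)] [∀ j, Module F (W j)]
    {σ : ∀ j, Representation F (GL (Fin n) F) (W j)} (hσ : ∀ j, HomRep d (σ j))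
    (f : ∀ j, V →ₗ[F] W j) (hf : ∀ j g v, f j (ρ g v) = σ j g (f j v))
    (hinj : ∀ v, (∀ j, f j v = 0) → v = 0) : HomRep d ρ := by
  have := fun j => (hσ j).finite
  have hV : Module.Finite F V := Module.Finite.of_injective (LinearMap.pi f)
    ((injective_iff_map_eq_zero _).2 fun v hv => hinj v fun j => congrFun hv j)
  refine .of_separating hV {φ | ∃ (j : J) (ψ : Module.Dual F (W j)), φ = ψ ∘ₗ f j}
    (fun v hv => hinj v fun j => ?_) ?_
  · exact (Module.forall_dual_apply_eq_zero_iff F _).1 fun ψ => hv _ ⟨j, ψ, rfl⟩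
  · rintro _ ⟨j, ψ, rfl⟩ v
    obtain ⟨a, ha, hag⟩ := (hσ j).coeff ψ (f j v)
    exact ⟨a, ha, fun g => by rw [LinearMap.comp_apply, hf, hag]⟩

/-- A representation spanned by the images of a finite family of polynomial representations. -/
lemma HomRep.of_jointly_surjective {J : Type*} [Finite J] {W : J → Type*}
    [∀ j, AddCommGroup (W j)] [∀ j, Module F (W j)]
    {σ : ∀ j, Representation F (GL (Fin n) F) (W j)} (hσ : ∀ j, HomRep d (σ j))
    (f : ∀ j, W j →ₗ[F] V) (hf : ∀ j g v, f j (σ j g v) = ρ g (f j v))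
    (hsurj : ⨆ j, LinearMap.range (f j) = ⊤) : HomRep d ρ := by
  have := fun j => (hσ j).finite
  refine ⟨?_, fun φ v => ?_⟩
  · rw [Module.finite_def, ← hsurj]
    exact Submodule.fg_iSup _ fun j => (Module.Finite.iff_fg (N := LinearMap.range (f j))).1
      inferInstance
  · refine Submodule.iSup_induction (fun j => LinearMap.range (f j)) (x := v)
      (motive := fun v => ∃ a ∈ homFun F (Fin n) (Fin n) d, ∀ g : GL (Fin n) F,
        φ (ρ g v) = a g.val) (by rw [hsurj]; trivial) ?_ ?_ ?_
    · rintro j _ ⟨w, rfl⟩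
      obtain ⟨a, ha, hag⟩ := (hσ j).coeff (φ ∘ₗ f j) w
      exact ⟨a, ha, fun g => by rw [← hf, ← hag]; rfl⟩
    · exact ⟨0, zero_mem _, fun g => by simp⟩
    · rintro v w ⟨a, ha, hag⟩ ⟨b, hb, hbg⟩
      exact ⟨a + b, add_mem ha hb, fun g => by simp [hag, hbg]⟩

lemma HomRep.of_injective {W : Type*} [AddCommGroup W] [Module F W]
    {σ : Representation F (GL (Fin n) F) W} (hσ : HomRep d σ) (f : V →ₗ[F] W)
    (hf : ∀ g v, f (ρ g v) = σ g (f v)) (hinj : Function.Injective f) : HomRep d ρ :=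
  .of_jointly_injective (J := Unit) (fun _ => hσ) (fun _ => f) (fun _ => hf)
    fun v hv => hinj (by rw [hv (), map_zero])

lemma HomRep.of_surjective {W : Type*} [AddCommGroup W] [Module F W]
    {σ : Representation F (GL (Fin n) F) W} (hσ : HomRep d σ) (f : W →ₗ[F] V)
    (hf : ∀ g v, f (σ g v) = ρ g (f v)) (hsurj : Function.Surjective f) : HomRep d ρ :=
  .of_jointly_surjective (J := Unit) (fun _ => hσ) (fun _ => f) (fun _ => hf)
    (by rw [iSup_const, LinearMap.range_eq_top.2 hsurj])

variable [Infinite F]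

/-- The density principle used throughout: identities between polynomial maps need only be checked
on invertible matrices. -/
lemma eq_of_GL {d' : ℕ} (a b : Matrix (Fin n) (Fin n) F → V)
    (ha : ∀ φ : Module.Dual F V, (fun x => φ (a x)) ∈ homFun F (Fin n) (Fin n) d)
    (hb : ∀ φ : Module.Dual F V, (fun x => φ (b x)) ∈ homFun F (Fin n) (Fin n) d')
    (h : ∀ g : GL (Fin n) F, a g.val = b g.val) (x : Matrix (Fin n) (Fin n) F) : a x = b x := by
  rw [← sub_eq_zero, ← Module.forall_dual_apply_eq_zero_iff F]
  intro φ
  rw [map_sub, sub_eq_zero]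
  exact congrFun (homFun_eq_of_GL (ha φ) (hb φ) fun g => by rw [h]) x

lemma HomRep.exists_extension (h : HomRep d ρ) :
    ∃ R : Matrix (Fin n) (Fin n) F →* Module.End F V, (∀ g : GL (Fin n) F, R g.val = ρ g) ∧
      ∀ (φ : Module.Dual F V) (v : V), (fun x => φ (R x v)) ∈ homFun F (Fin n) (Fin n) d := by
  classical
  have := h.finite
  let b := Module.finBasis F V
  choose f hf hfg using fun i j => h.coeff (b.coord i) (b j)
  let R : Matrix (Fin n) (Fin n) F → Module.End F V := fun x =>
    Matrix.toLin b b (Matrix.of fun i j => f i j x)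
  have hR : ∀ g : GL (Fin n) F, R g.val = ρ g := fun g => b.ext fun j => by
    rw [Matrix.toLin_self]
    conv_rhs => rw [← b.sum_repr (ρ g (b j))]
    refine Finset.sum_congr rfl fun i _ => ?_
    rw [Matrix.of_apply, ← hfg]; rfl
  have hc : ∀ (φ : Module.Dual F V) (v : V),
      (fun x => φ (R x v)) ∈ homFun F (Fin n) (Fin n) d := fun φ v => by
    have : (fun x => φ (R x v)) = ∑ j, ∑ i, (b.repr v j * φ (b i)) • f i j := by
      funext x
      conv_lhs => rw [← b.sum_repr v]
      simp only [map_sum, map_smul, R, Matrix.toLin_self, Matrix.of_apply, Finset.sum_apply,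
        Pi.smul_apply, smul_eq_mul, Finset.mul_sum]
      exact Finset.sum_congr rfl fun j _ => Finset.sum_congr rfl fun i _ => by ring
    rw [this]
    exact sum_mem fun j _ => sum_mem fun i _ => Submodule.smul_mem _ _ (hf i j)
  refine ⟨{ toFun := R, map_one' := ?_, map_mul' := ?_ }, hR, hc⟩
  · simpa using hR 1
  · have h1 : ∀ (g : GL (Fin n) F) x v, R (x * g.val) v = R x (R g.val v) := fun g x v =>
      eq_of_GL (fun x => R (x * g.val) v) (fun x => R x (R g.val v))
        (fun φ => homFun_comp_mul_right (hc φ v) g.val) (fun φ => hc φ _)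
        (fun g' => by
          have := hR (g' * g)
          rw [Units.val_mul] at this
          simp only [this, hR, map_mul, Module.End.mul_apply]) x
    intro x y
    refine LinearMap.ext fun v => ?_
    exact eq_of_GL (fun y => R (x * y) v) (fun y => R x (R y v))
        (fun φ => homFun_comp_mul_left (hc φ v) x) (fun φ => hc (φ ∘ₗ R x) v)
        (fun g => h1 g x v) y

/-- The extension of a polynomial representation to the monoid of all matrices. -/
def HomRep.mat (h : HomRep d ρ) : Matrix (Fin n) (Fin n) F →* Module.End F V :=
  h.exists_extension.choose

lemma HomRep.mat_GL (h : HomRep d ρ) (g : GL (Fin n) F) : h.mat g.val = ρ g :=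
  h.exists_extension.choose_spec.1 g

lemma HomRep.mat_coeff (h : HomRep d ρ) (φ : Module.Dual F V) (v : V) :
    (fun x => φ (h.mat x v)) ∈ homFun F (Fin n) (Fin n) d :=
  h.exists_extension.choose_spec.2 φ v

lemma HomRep.mat_mul (h : HomRep d ρ) (x y : Matrix (Fin n) (Fin n) F) (v : V) :
    h.mat (x * y) v = h.mat x (h.mat y v) := by
  rw [map_mul, Module.End.mul_apply]

lemma HomRep.mat_map (h : HomRep d ρ) {d' : ℕ} {W : Type*} [AddCommGroup W] [Module F W]
    {σ : Representation F (GL (Fin n) F) W} (hσ : HomRep d' σ) (f : V →ₗ[F] W)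
    (hf : ∀ g v, f (ρ g v) = σ g (f v)) (x : Matrix (Fin n) (Fin n) F) (v : V) :
    f (h.mat x v) = hσ.mat x (f v) :=
  eq_of_GL (fun x => f (h.mat x v)) (fun x => hσ.mat x (f v)) (fun φ => h.mat_coeff (φ ∘ₗ f) v)
    (fun φ => hσ.mat_coeff φ _) (fun g => by rw [h.mat_GL, hσ.mat_GL, hf]) x

/-- The class of x v in V/W is polynomial in x and vanishes for invertible x. -/
lemma HomRep.mat_mem (h : HomRep d ρ) (W : Submodule F V) (v : V)
    (hW : ∀ g, ρ g v ∈ W) (x : Matrix (Fin n) (Fin n) F) : h.mat x v ∈ W := by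
  rw [← Submodule.Quotient.mk_eq_zero]
  exact eq_of_GL (d' := d) (fun x => W.mkQ (h.mat x v)) (fun _ => 0)
    (fun φ => h.mat_coeff (φ ∘ₗ W.mkQ) v) (fun φ => by simp only [map_zero]; exact zero_mem _)
    (fun g => by rw [h.mat_GL]; simpa using hW g) x

end Closure

/-! ### Block matrices and `S`-invariants -/

section Blocks

variable {n : ℕ}

/-- The block matrix with blocks `a, z` above `y, t`. -/
def blk (a : Matrix (Fin n) (Fin n) F) (z : Matrix (Fin n) (Fin 1) F)
    (y : Matrix (Fin 1) (Fin n) F) (t : Matrix (Fin 1) (Fin 1) F) :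
    Matrix (Fin (n + 1)) (Fin (n + 1)) F :=
  Matrix.reindex finSumFinEquiv finSumFinEquiv (Matrix.fromBlocks a z y t)

lemma blk_mul (a a' : Matrix (Fin n) (Fin n) F) (z z' : Matrix (Fin n) (Fin 1) F)
    (y y' : Matrix (Fin 1) (Fin n) F) (t t' : Matrix (Fin 1) (Fin 1) F) :
    blk a z y t * blk a' z' y' t' =
      blk (a * a' + z * y') (a * z' + z * t') (y * a' + t * y') (y * z' + t * t') := by
  simp [blk, Matrix.submatrix_mul_equiv, Matrix.fromBlocks_multiply]

omit [Field F] in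
lemma exists_eq_blk (x : Matrix (Fin (n + 1)) (Fin (n + 1)) F) :
    ∃ a z y t, x = blk a z y t := by
  let x' := Matrix.reindex finSumFinEquiv.symm finSumFinEquiv.symm x
  refine ⟨x'.toBlocks₁₁, x'.toBlocks₁₂, x'.toBlocks₂₁, x'.toBlocks₂₂, ?_⟩
  rw [blk, Matrix.fromBlocks_toBlocks]
  simp [x']

lemma embed_val (g : GL (Fin n) F) : (embed g).val = blk g.val 0 0 1 := rfl

lemma subtorus_val (s : Fˣ) : (subtorus s : GL (Fin (n + 1)) F).val =
    blk 1 0 0 ((s : F) • 1) := by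
  have h1 : ∀ i : Fin n, i.castSucc = finSumFinEquiv (Sum.inl i : Fin n ⊕ Fin 1) := by
    intro i; ext; simp
  have h2 : (Fin.last n) = finSumFinEquiv (Sum.inr (0 : Fin 1)) := by
    ext; simp
  have h3 : (fun i => ((Fin.snoc (fun _ => 1) s : Fin (n + 1) → Fˣ) i : F)) ∘ finSumFinEquiv =
      Sum.elim (fun _ => 1) (fun _ => (s : F)) := by
    funext i
    rcases i with i | i
    · simp only [Function.comp_apply]
      rw [← h1]; simp
    · obtain rfl : i = 0 := Subsingleton.elim _ _
      simp only [Function.comp_apply]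
      rw [← h2]; simp
  have h4 : Matrix.reindex finSumFinEquiv.symm finSumFinEquiv.symm
      (subtorus s : GL (Fin (n + 1)) F).val =
      Matrix.fromBlocks (1 : Matrix (Fin n) (Fin n) F) 0 0 ((s : F) • (1 : Matrix (Fin 1) (Fin 1) F)) := by
    simp only [subtorus, diag, Matrix.reindex_apply, Equiv.symm_symm]
    rw [Matrix.submatrix_diagonal_equiv, h3, ← Matrix.fromBlocks_diagonal, Matrix.diagonal_one,
      Matrix.smul_one_eq_diagonal]
  rw [blk, ← h4]
  simp

/-- The matrix with upper left block `a` and zeros elsewhere. -/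
def corner (a : Matrix (Fin n) (Fin n) F) : Matrix (Fin (n + 1)) (Fin (n + 1)) F := blk a 0 0 0

lemma corner_mul (a b : Matrix (Fin n) (Fin n) F) : corner a * corner b = corner (a * b) := by
  simp [corner, blk_mul]

lemma embed_mul_corner (g : GL (Fin n) F) (a : Matrix (Fin n) (Fin n) F) :
    (embed g).val * corner a = corner (g.val * a) := by
  simp [corner, blk_mul, embed_val]

lemma exists_corner_mul_mul_corner (x : Matrix (Fin (n + 1)) (Fin (n + 1)) F) :
    ∃ a : Matrix (Fin n) (Fin n) F, corner 1 * x * corner 1 = corner a := by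
  obtain ⟨a, z, y, t, rfl⟩ := exists_eq_blk x
  exact ⟨a, by simp [corner, blk_mul]⟩

/-- `corner` as a linear map. -/
def cornerLin : Matrix (Fin n) (Fin n) F →ₗ[F] Matrix (Fin (n + 1)) (Fin (n + 1)) F where
  toFun := corner
  map_add' a b := by
    rw [corner, corner, corner, blk, blk, blk]
    ext i j
    obtain ⟨i, rfl⟩ := finSumFinEquiv.surjective i
    obtain ⟨j, rfl⟩ := finSumFinEquiv.surjective j
    rcases i with i | i <;> rcases j with j | j <;> simp
  map_smul' c a := by
    rw [corner, corner, blk, blk]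
    ext i j
    obtain ⟨i, rfl⟩ := finSumFinEquiv.surjective i
    obtain ⟨j, rfl⟩ := finSumFinEquiv.surjective j
    rcases i with i | i <;> rcases j with j | j <;> simp

variable {d : ℕ} {V : Type*} [AddCommGroup V] [Module F V]
  {ρ : Representation F (GL (Fin (n + 1)) F) V}

/-- The `S`-invariants are the image of the idempotent `diag(1, …, 1, 0)`. -/
lemma HomRep.mem_invariants_iff [Infinite F] (h : HomRep d ρ) (v : V) :
    v ∈ invariants ρ ↔ h.mat (corner 1) v = v := by
  constructor
  · intro hv
    rw [← sub_eq_zero, ← Module.forall_dual_apply_eq_zero_iff F]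
    intro φ
    obtain ⟨P, -, hP⟩ := mem_homFun.1 (h.mat_coeff φ v)
    -- This line runs through diag(1,…,1,s), so it lies in `S` for s ≠ 0 and meets `corner 1` at s =
    -- 0. A coefficient constant for s ≠ 0 is constant.
    obtain ⟨q, hq⟩ := eval_line P (corner 1) (blk 0 0 0 1)
    have hline : ∀ s : F, (fun ij : Fin (n + 1) × Fin (n + 1) =>
        (corner 1 : Matrix (Fin (n + 1)) (Fin (n + 1)) F) ij.1 ij.2 +
          s * (blk 0 0 0 1 : Matrix (Fin (n + 1)) (Fin (n + 1)) F) ij.1 ij.2) =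
        fun ij => blk 1 0 0 (s • 1) ij.1 ij.2 := fun s => by
      funext ⟨i, j⟩
      obtain ⟨i, rfl⟩ := finSumFinEquiv.surjective i
      obtain ⟨j, rfl⟩ := finSumFinEquiv.surjective j
      rcases i with i | i <;> rcases j with j | j <;> simp [corner, blk]
    have h1 : q = Polynomial.C (φ v) := polynomial_eq_of_units fun s => by
      rw [hq, hline, ← subtorus_val, ← hP, h.mat_GL, hv s, Polynomial.eval_C]
    have h2 := hq 0
    simp only [zero_mul, add_zero] at h2
    rw [← hP, h1, Polynomial.eval_C] at h2
    rw [map_sub, ← h2, sub_self]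
  · intro hv s
    rw [← hv, ← h.mat_GL, ← h.mat_mul]
    congr 2
    simp [corner, blk_mul, subtorus_val]

lemma HomRep.corner_mem_invariants [Infinite F] (h : HomRep d ρ)
    (a : Matrix (Fin n) (Fin n) F) (v : V) : h.mat (corner a) v ∈ invariants ρ := by
  rw [h.mem_invariants_iff, ← h.mat_mul, corner_mul, one_mul]

lemma HomRep.invRep [IsAlgClosed F] (h : HomRep d ρ) : HomRep d (invRep ρ) :=
  (invRep_isPolynomial h.isPolynomial).homRep

/-- For invertible g an invariant v satisfies v = e v, and `embed g` times e is `corner g`; density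
does the rest. -/
lemma HomRep.invRep_mat [IsAlgClosed F] (h : HomRep d ρ) (a : Matrix (Fin n) (Fin n) F)
    (v : invariants ρ) : (h.invRep.mat a v : V) = h.mat (corner a) v :=
  eq_of_GL (fun a => (h.invRep.mat a v : V)) (fun a => h.mat (corner a) v)
    (fun φ => h.invRep.mat_coeff (φ ∘ₗ (invariants ρ).subtype) v)
    (fun φ => homFun_comp_linear (h.mat_coeff φ v) cornerLin)
    (fun g => by
      rw [h.invRep.mat_GL, invRep_coe, ← h.mat_GL]
      conv_lhs => rw [← (h.mem_invariants_iff v.1).1 v.2]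
      rw [← h.mat_mul, embed_mul_corner, mul_one]) a

end Blocks

/-! ### Exactness -/

section Retract

variable {C D J : Type*} [Category* C] [Category* D] [Category* J] {G H : C ⥤ D}

/-- Lifts are formed after `H` and pushed back along `r`; uniqueness holds because `i` is a split
monomorphism. The intended `G` is M ↦ M^S, a retract of the underlying space functor. -/
lemma preservesLimitsOfShape_of_retract (i : G ⟶ H) (r : H ⟶ G) (hir : i ≫ r = 𝟙 G)
    [PreservesLimitsOfShape J H] : PreservesLimitsOfShape J G where
  preservesLimit {K} :=
    { preserves := fun {c} hc => by
        have hH := isLimitOfPreserves H hc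
        have hir' : ∀ X, i.app X ≫ r.app X = 𝟙 _ := fun X => NatTrans.congr_app hir X
        let l : ∀ s : Cone (K ⋙ G), s.pt ⟶ H.obj c.pt := fun s =>
          hH.lift ((Cone.postcompose (Functor.whiskerLeft K i)).obj s)
        have hl : ∀ s j, l s ≫ H.map (c.π.app j) = s.π.app j ≫ i.app (K.obj j) := fun s j =>
          hH.fac ((Cone.postcompose (Functor.whiskerLeft K i)).obj s) j
        refine ⟨{ lift := fun s => l s ≫ r.app c.pt, fac := fun s j => ?_, uniq := fun s m hm => ?_ }⟩
        · change (l s ≫ r.app c.pt) ≫ G.map (c.π.app j) = s.π.app j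
          rw [Category.assoc, ← r.naturality, ← Category.assoc, hl, Category.assoc, hir']
          exact Category.comp_id (s.π.app j)
        · have : m ≫ i.app c.pt = l s := hH.hom_ext fun j => by
            change (m ≫ i.app c.pt) ≫ H.map (c.π.app j) = l s ≫ H.map (c.π.app j)
            rw [hl, Category.assoc, ← i.naturality, ← Category.assoc]
            exact congrArg (· ≫ i.app (K.obj j)) (hm j)
          rw [← this, Category.assoc, hir']
          exact (Category.comp_id m).symm }

lemma preservesColimitsOfShape_of_retract (i : G ⟶ H) (r : H ⟶ G) (hir : i ≫ r = 𝟙 G)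
    [PreservesColimitsOfShape J H] : PreservesColimitsOfShape J G where
  preservesColimit {K} :=
    { preserves := fun {c} hc => by
        have hH := isColimitOfPreserves H hc
        have hir' : ∀ X, i.app X ≫ r.app X = 𝟙 _ := fun X => NatTrans.congr_app hir X
        let l : ∀ s : Cocone (K ⋙ G), H.obj c.pt ⟶ s.pt := fun s =>
          hH.desc ((Cocone.precompose (Functor.whiskerLeft K r)).obj s)
        have hl : ∀ s j, H.map (c.ι.app j) ≫ l s = r.app (K.obj j) ≫ s.ι.app j := fun s j =>
          hH.fac ((Cocone.precompose (Functor.whiskerLeft K r)).obj s) j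
        refine ⟨{ desc := fun s => i.app c.pt ≫ l s, fac := fun s j => ?_, uniq := fun s m hm => ?_ }⟩
        · change G.map (c.ι.app j) ≫ i.app c.pt ≫ l s = s.ι.app j
          have h := i.naturality_assoc (c.ι.app j) (l s)
          refine h.trans ?_
          rw [hl, ← Category.assoc, hir', Category.id_comp]
        · have : r.app c.pt ≫ m = l s := hH.hom_ext fun j => by
            change H.map (c.ι.app j) ≫ r.app c.pt ≫ m = H.map (c.ι.app j) ≫ l s
            rw [hl]
            refine (r.naturality_assoc (c.ι.app j) m).trans ?_
            exact congrArg (r.app (K.obj j) ≫ ·) (hm j)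
          rw [← this, ← Category.assoc, hir']
          exact (Category.id_comp m).symm }

end Retract

/-! ### Finite limits and colimits of polynomial representations; exactness of τ. -/

section Exactness

variable [IsAlgClosed F] {n d : ℕ}

lemma PolRep.homRep (M : PolRep F n d) : HomRep d M.obj.ρ := IsPolynomial.homRep M.property

lemma HomRep.polProp {M : Rep.{u} F (GL (Fin n) F)} (h : HomRep d M.ρ) :
    PolyGL.polProp F n d M := h.isPolynomial

/-- A linear isomorphism commuting with the group action gives an isomorphism in `Rep^d`. -/
def polIso {M N : PolRep F n d} (e : M.obj.V ≃ₗ[F] N.obj.V)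
    (he : ∀ g v, e (M.obj.ρ g v) = N.obj.ρ g (e v)) : M ≅ N :=
  (polProp F n d).isoMk (Rep.mkIso (.mk e fun g => LinearMap.ext (he g)))

/-- The common kernel of the projections of a limit is a subrepresentation whose inclusion agrees
with zero after every projection, hence is zero. So the limit embeds jointly into finitely many
polynomial representations. -/
instance (J : Type) [SmallCategory J] [FinCategory J] :
    (polProp F n d).IsClosedUnderLimitsOfShape J where
  limitsOfShape_le := by
    rintro X ⟨p⟩
    have hp : ∀ j, HomRep d (p.diag.obj j).ρ := fun j =>
      PolRep.homRep ⟨_, p.prop_diag_obj j⟩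
    refine HomRep.polProp (.of_jointly_injective hp (fun j => (p.π.app j).hom.toLinearMap)
      (fun j g v => Rep.hom_comm_apply (p.π.app j) g v) fun v hv => ?_)
    let W : Submodule F X.V := ⨅ j, LinearMap.ker (p.π.app j).hom.toLinearMap
    have hW : ∀ g, W ≤ W.comap (X.ρ g) := fun g w hw => by
      simp only [W, Submodule.mem_comap, Submodule.mem_iInf, LinearMap.mem_ker] at hw ⊢
      intro j
      exact (Rep.hom_comm_apply (p.π.app j) g w).trans ((congrArg _ (hw j)).trans (map_zero _))
    have h0 : Rep.subtype X W hW = 0 := p.isLimit.hom_ext fun j => by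
      rw [zero_comp]
      refine Rep.hom_ext (Representation.IntertwiningMap.ext (LinearMap.ext fun w => ?_))
      exact (Submodule.mem_iInf _).1 w.2 j
    have hvW : v ∈ W := (Submodule.mem_iInf _).2 hv
    exact congrArg (fun f : Rep.subrepresentation X W hW ⟶ X => f.hom ⟨v, hvW⟩) h0

/-- Dually, the quotient of a colimit by the sum of the images of the coprojections is zero. -/
instance (J : Type) [SmallCategory J] [FinCategory J] :
    (polProp F n d).IsClosedUnderColimitsOfShape J where
  colimitsOfShape_le := by
    rintro X ⟨p⟩
    have hp : ∀ j, HomRep d (p.diag.obj j).ρ := fun j =>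
      PolRep.homRep ⟨_, p.prop_diag_obj j⟩
    refine HomRep.polProp (.of_jointly_surjective hp (fun j => (p.ι.app j).hom.toLinearMap)
      (fun j g v => Rep.hom_comm_apply (p.ι.app j) g v) ?_)
    set W : Submodule F X.V := ⨆ j, LinearMap.range (p.ι.app j).hom.toLinearMap with hWdef
    have hW : ∀ g, W ≤ W.comap (X.ρ g) := fun g => iSup_le fun j => by
      rintro _ ⟨w, rfl⟩
      exact Submodule.mem_iSup_of_mem j ⟨_, Rep.hom_comm_apply (p.ι.app j) g w⟩
    have h0 : Rep.mkQ X W hW = 0 := p.isColimit.hom_ext fun j => by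
      rw [comp_zero]
      refine Rep.hom_ext (Representation.IntertwiningMap.ext (LinearMap.ext fun w => ?_))
      exact (Submodule.Quotient.mk_eq_zero W).2 (Submodule.mem_iSup_of_mem j ⟨w, rfl⟩)
    refine eq_top_iff.2 fun v _ => (Submodule.Quotient.mk_eq_zero W).1 ?_
    exact congrArg (fun f : X ⟶ Rep.quotient X W hW => f.hom v) h0

variable (F n d)

/-- The underlying vector space of a polynomial representation. -/
abbrev underlying : PolRep F n d ⥤ ModuleCat.{u} F :=
  (polProp F n d).ι ⋙ forget₂ (Rep.{u} F (GL (Fin n) F)) (ModuleCat.{u} F)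

/-- The inclusion `M^S ⟶ M` of vector spaces. -/
def invInclusion : tau F n d ⋙ underlying F n d ⟶ underlying F (n + 1) d where
  app M := ModuleCat.ofHom (invariants M.obj.ρ).subtype
  naturality _ _ _ := rfl

/-- The projection `M ⟶ M^S` of vector spaces. -/
def invProjection : underlying F (n + 1) d ⟶ tau F n d ⋙ underlying F n d where
  app M := ModuleCat.ofHom
    ((M.homRep.mat (corner 1)).codRestrict (invariants M.obj.ρ)
      (M.homRep.corner_mem_invariants 1))
  naturality M N f := by
    apply ModuleCat.hom_ext
    refine LinearMap.ext fun v => Subtype.ext ?_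
    exact (M.homRep.mat_map N.homRep f.hom.hom.toLinearMap
      (fun g v => Rep.hom_comm_apply f.hom g v) (corner 1) v).symm

lemma invInclusion_projection : invInclusion F n d ≫ invProjection F n d = 𝟙 _ := by
  ext M v
  exact Subtype.ext <| (M.homRep.mem_invariants_iff v.1).1 v.2

lemma tau_preservesFiniteLimits : PreservesFiniteLimits (tau F n d) where
  preservesFiniteLimits J _ _ := by
    -- These instances only lower the universe of the diagrams to that of finite shapes.
    have : PreservesLimitsOfSize.{0, 0}
        (forget₂ (Rep.{u} F (GL (Fin (n + 1)) F)) (ModuleCat.{u} F)) :=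
      preservesLimitsOfSize_shrink.{0, u, 0, u} _
    have : ReflectsLimitsOfSize.{0, 0}
        (forget₂ (Rep.{u} F (GL (Fin n) F)) (ModuleCat.{u} F)) :=
      reflectsLimitsOfSize_shrink.{0, u, 0, u} _
    have : HasLimitsOfSize.{0, 0} (Rep.{u} F (GL (Fin (n + 1)) F)) :=
      hasLimitsOfSizeShrink.{0, 0, u, u} _
    have : PreservesLimitsOfShape J (tau F n d ⋙ underlying F n d) :=
      preservesLimitsOfShape_of_retract _ _ (invInclusion_projection F n d)
    exact preservesLimitsOfShape_of_reflects_of_preserves (tau F n d) (underlying F n d)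

lemma tau_preservesFiniteColimits : PreservesFiniteColimits (tau F n d) where
  preservesFiniteColimits J _ _ := by
    have : PreservesColimitsOfSize.{0, 0}
        (forget₂ (Rep.{u} F (GL (Fin (n + 1)) F)) (ModuleCat.{u} F)) :=
      preservesColimitsOfSize_shrink.{0, u, 0, u} _
    have : ReflectsColimitsOfSize.{0, 0}
        (forget₂ (Rep.{u} F (GL (Fin n) F)) (ModuleCat.{u} F)) :=
      reflectsColimitsOfSize_shrink.{0, u, 0, u} _
    have : HasColimitsOfSize.{0, 0} (Rep.{u} F (GL (Fin (n + 1)) F)) :=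
      hasColimitsOfSizeShrink.{0, 0, u, u} _
    have : PreservesColimitsOfShape J (tau F n d ⋙ underlying F n d) :=
      preservesColimitsOfShape_of_retract _ _ (invInclusion_projection F n d)
    exact preservesColimitsOfShape_of_reflects_of_preserves (tau F n d) (underlying F n d)

end Exactness

/-! ### Weyl modules are polynomial -/

section Blocks

variable {n : ℕ}

section Entries

variable (a : Matrix (Fin n) (Fin n) F) (z : Matrix (Fin n) (Fin 1) F)
  (y : Matrix (Fin 1) (Fin n) F) (t : Matrix (Fin 1) (Fin 1) F)

lemma castSucc_eq_finSumFinEquiv (i : Fin n) :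
    i.castSucc = finSumFinEquiv (Sum.inl i : Fin n ⊕ Fin 1) := by
  ext; simp

lemma last_eq_finSumFinEquiv : Fin.last n = finSumFinEquiv (Sum.inr (0 : Fin 1)) := by
  ext; simp

omit [Field F] in
lemma blk_castSucc_castSucc (i j : Fin n) : blk a z y t i.castSucc j.castSucc = a i j := by
  rw [castSucc_eq_finSumFinEquiv, castSucc_eq_finSumFinEquiv, blk]; simp

omit [Field F] in
lemma blk_last_castSucc (j : Fin n) : blk a z y t (Fin.last n) j.castSucc = y 0 j := by
  rw [castSucc_eq_finSumFinEquiv, last_eq_finSumFinEquiv, blk]; simp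

omit [Field F] in
lemma blk_castSucc_last (i : Fin n) : blk a z y t i.castSucc (Fin.last n) = z i 0 := by
  rw [castSucc_eq_finSumFinEquiv, last_eq_finSumFinEquiv, blk]; simp

omit [Field F] in
lemma blk_last_last : blk a z y t (Fin.last n) (Fin.last n) = t 0 0 := by
  rw [last_eq_finSumFinEquiv, blk]; simp

lemma det_blk_lower : (blk a 0 y 1).det = a.det := by
  simp [blk]

end Entries

lemma blk_blockTriangular {a : Matrix (Fin n) (Fin n) F} (ha : a.BlockTriangular id)
    (z : Matrix (Fin n) (Fin 1) F) (t : Matrix (Fin 1) (Fin 1) F) :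
    (blk a z 0 t).BlockTriangular id := by
  intro i j hij
  refine Fin.lastCases (fun hij => ?_) (fun i hij => ?_) i hij <;>
    refine Fin.lastCases (fun hij => ?_) (fun j hij => ?_) j hij
  · exact absurd hij (lt_irrefl _)
  · rw [blk_last_castSucc]; rfl
  · exact absurd hij (not_lt.2 (Fin.castSucc_lt_last i).le)
  · rw [blk_castSucc_castSucc]; exact ha (by simpa using hij)

lemma borelChar_of_blk (wt : Fin (n + 1) → ℤ) {b : GL (Fin (n + 1)) F}
    {a : Matrix (Fin n) (Fin n) F} {z : Matrix (Fin n) (Fin 1) F} {y : Matrix (Fin 1) (Fin n) F}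
    {t : Matrix (Fin 1) (Fin 1) F} (hb : b.val = blk a z y t) :
    borelChar wt b = (∏ i, a i i ^ wt i.castSucc) * t 0 0 ^ wt (Fin.last n) := by
  rw [borelChar, Fin.prod_univ_castSucc, hb, blk_last_last]
  simp_rw [blk_castSucc_castSucc]

/-- Block LU decomposition on the open set where the upper left block is invertible. -/
lemma exists_block_decomposition (g : GL (Fin (n + 1)) F)
    (hg : (g.val.submatrix Fin.castSucc Fin.castSucc).det ≠ 0) :
    ∃ (a : GL (Fin n) F) (z : Matrix (Fin n) (Fin 1) F) (y : Matrix (Fin 1) (Fin n) F)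
      (t : Matrix (Fin 1) (Fin 1) F) (p b : GL (Fin (n + 1)) F), g = p * b ∧
      p.val = blk a.val 0 y 1 ∧ b.val = blk 1 z 0 t := by
  obtain ⟨a, z, y, t, hx⟩ := exists_eq_blk g.val
  have ha : a.det ≠ 0 := by
    convert hg using 2
    ext i j
    rw [Matrix.submatrix_apply, hx, blk_castSucc_castSucc]
  let a' : GL (Fin n) F := Matrix.GeneralLinearGroup.mkOfDetNeZero a ha
  let p : GL (Fin (n + 1)) F :=
    Matrix.GeneralLinearGroup.mkOfDetNeZero (blk a 0 y 1) (by rwa [det_blk_lower])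
  refine ⟨a', a⁻¹ * z, y, t - y * (a⁻¹ * z), p, p⁻¹ * g, by simp, rfl, ?_⟩
  have h1 : g.val = p.val * blk 1 (a⁻¹ * z) 0 (t - y * (a⁻¹ * z)) := by
    have h2 : a * (a⁻¹ * z) = z := by
      rw [← Matrix.mul_assoc, Matrix.mul_nonsing_inv _ (isUnit_iff_ne_zero.2 ha), Matrix.one_mul]
    change g.val = blk a 0 y 1 * _
    rw [blk_mul, h2, hx]
    simp
  rw [Units.val_mul, h1, ← mul_assoc, ← Units.val_mul, inv_mul_cancel, Units.val_one, one_mul]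

variable {V : Type*} [AddCommGroup V] [Module F V]
  {ρ : Representation F (GL (Fin (n + 1)) F) V}

/-- The leading n × n minor is a nonzero polynomial, so its nonvanishing locus is dense; modulo `W`
every coefficient of g v vanishes there. -/
lemma IsRational.mem_of_dense [Infinite F] (h : IsRational ρ) (W : Submodule F V) (v : V)
    (hW : ∀ g : GL (Fin (n + 1)) F, (g.val.submatrix Fin.castSucc Fin.castSucc).det ≠ 0 →
      ρ g v ∈ W) (g : GL (Fin (n + 1)) F) : ρ g v ∈ W := by
  rw [← Submodule.Quotient.mk_eq_zero, ← Module.forall_dual_apply_eq_zero_iff F]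
  intro φ
  obtain ⟨P, k, hP⟩ := h.coeff (φ ∘ₗ W.mkQ) v
  let Q : MvPolynomial (Fin (n + 1) × Fin (n + 1)) F :=
    ((Matrix.mvPolynomialX (Fin (n + 1)) (Fin (n + 1)) F).submatrix Fin.castSucc Fin.castSucc).det
  have hQe : ∀ x : Matrix (Fin (n + 1)) (Fin (n + 1)) F,
      MvPolynomial.eval (fun ij => x ij.1 ij.2) Q =
        (x.submatrix Fin.castSucc Fin.castSucc).det := fun x =>
    eval_det_submatrix_mvPolynomialX _ _ _
  have hQ : Q ≠ 0 := fun h0 => by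
    have := hQe 1
    rw [h0, map_zero, Matrix.submatrix_one _ (Fin.castSucc_injective n), Matrix.det_one] at this
    exact zero_ne_one this
  have hPQ : P * Q = 0 := polynomial_eq_zero_of_GL fun g => by
    rw [map_mul, hQe]
    by_cases hg : (g.val.submatrix Fin.castSucc Fin.castSucc).det = 0
    · rw [hg, mul_zero]
    · have hd : g.val.det ≠ 0 := g.isUnit.map (Matrix.detMonoidHom) |>.ne_zero
      have h1 := hP g
      have h2 : (φ ∘ₗ W.mkQ) (ρ g v) = 0 := by
        rw [LinearMap.comp_apply, Submodule.mkQ_apply,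
          (Submodule.Quotient.mk_eq_zero W).2 (hW g hg), map_zero]
      rw [h2, eq_comm, mul_eq_zero] at h1
      rw [h1.resolve_right (inv_ne_zero (pow_ne_zero _ hd)), zero_mul]
  have h3 := hP g
  rw [(mul_eq_zero.1 hPQ).resolve_right hQ, map_zero, zero_mul] at h3
  exact h3

/-- A highest weight vector of weight `wt`. -/
def IsBorelVec {m : ℕ} (ρ : Representation F (GL (Fin m) F) V) (wt : Fin m → ℤ) (v : V) : Prop :=
  ∀ b : GL (Fin m) F, b.val.BlockTriangular id → ρ b v = borelChar wt b • v

lemma IsBorelVec.subtorus {wt : Fin (n + 1) → ℤ} {v : V} (hv : IsBorelVec ρ wt v) (s : Fˣ) :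
    ρ (subtorus s) v = (s : F) ^ wt (Fin.last n) • v := by
  rw [hv _ (by rw [subtorus_val]; exact blk_blockTriangular Matrix.blockTriangular_one _ _),
    borelChar_of_blk wt (subtorus_val s)]
  simp

/-- By density it suffices to treat g v with g = p b; b only rescales v. Moving diag(1,…,1,s) past p
replaces its lower row y by s y and produces the factor s^(λ_last). The determinant of the new
matrix does not depend on s, so no pole in s arises. -/
lemma IsRational.subtorus_coeff [Infinite F] (h : IsRational ρ) {wt : Fin (n + 1) → ℤ} {v : V}
    (hv : IsBorelVec ρ wt v) (hwt : ∀ i, 0 ≤ wt i)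
    (hspan : Submodule.span F (Set.range fun g => ρ g v) = ⊤) (w : V) (φ : Module.Dual F V) :
    ∃ q : Polynomial F, ∀ s : Fˣ, φ (ρ (subtorus s) w) = q.eval (s : F) := by
  let W : Submodule F V :=
    { carrier := {w | ∃ q : Polynomial F, ∀ s : Fˣ, φ (ρ (PolyGL.subtorus s) w) = q.eval (s : F)}
      add_mem' := by
        rintro a b ⟨q, hq⟩ ⟨r, hr⟩
        exact ⟨q + r, fun s => by simp [hq, hr]⟩
      zero_mem' := ⟨0, by simp⟩
      smul_mem' := by
        rintro c a ⟨q, hq⟩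
        exact ⟨Polynomial.C c * q, fun s => by simp [hq]⟩ }
  suffices hW : W = ⊤ by
    have : w ∈ W := hW ▸ Submodule.mem_top
    exact this
  rw [eq_top_iff, ← hspan, Submodule.span_le]
  rintro _ ⟨g, rfl⟩
  refine h.mem_of_dense W v (fun g hg => ?_) g
  obtain ⟨a, z, y, t, p, b, rfl, hp, hb⟩ := exists_block_decomposition g hg
  rw [map_mul, Module.End.mul_apply,
    hv b (by rw [hb]; exact blk_blockTriangular Matrix.blockTriangular_one _ _), map_smul]
  refine W.smul_mem _ ?_
  have ha : a.val.det ≠ 0 := a.isUnit.map (Matrix.detMonoidHom) |>.ne_zero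
  obtain ⟨P, k, hP⟩ := h.coeff φ v
  obtain ⟨q, hq⟩ := eval_line P (blk a.val 0 0 1) (blk 0 0 y 0)
  refine ⟨Polynomial.X ^ (wt (Fin.last n)).toNat * Polynomial.C (a.val.det ^ k)⁻¹ * q,
    fun s => ?_⟩
  let p' : GL (Fin (n + 1)) F := Matrix.GeneralLinearGroup.mkOfDetNeZero
    (blk a.val 0 ((s : F) • y) 1) (by rwa [det_blk_lower])
  have hpp : PolyGL.subtorus s * p = p' * PolyGL.subtorus s := by
    apply Units.ext
    rw [Units.val_mul, Units.val_mul, hp, subtorus_val]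
    change _ = blk a.val 0 ((s : F) • y) 1 * _
    rw [blk_mul, blk_mul]
    simp
  have hline : (fun ij : Fin (n + 1) × Fin (n + 1) => (blk a.val 0 0 1 ij.1 ij.2 : F) +
      s * (blk 0 0 y 0 ij.1 ij.2 : F)) = fun ij => p'.val ij.1 ij.2 := by
    change _ = fun ij : Fin (n + 1) × Fin (n + 1) => blk a.val 0 ((s : F) • y) 1 ij.1 ij.2
    funext ⟨i, j⟩
    refine Fin.lastCases ?_ (fun i => ?_) i <;> refine Fin.lastCases ?_ (fun j => ?_) j <;>
      simp [blk_castSucc_castSucc, blk_castSucc_last, blk_last_castSucc, blk_last_last]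
  rw [← Module.End.mul_apply, ← map_mul, hpp, map_mul, Module.End.mul_apply, hv.subtorus,
    map_smul, map_smul, hP, ← hline, ← hq]
  have hdet : p'.val.det = a.val.det := det_blk_lower _ _
  rw [hdet]
  simp only [Polynomial.eval_mul, Polynomial.eval_pow, Polynomial.eval_X, Polynomial.eval_C,
    smul_eq_mul]
  rw [← zpow_natCast (s : F) (wt _).toNat, Int.toNat_of_nonneg (hwt _)]
  ring

end Blocks

/-! ### Permutation of weights, and polynomiality from a highest weight vector. -/

section Weights

variable {n : ℕ} {V : Type*} [AddCommGroup V] [Module F V]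

/-- The permutation matrix of `σ`. -/
def permGL (σ : Equiv.Perm (Fin n)) : GL (Fin n) F :=
  Matrix.GeneralLinearGroup.mkOfDetNeZero (σ.permMatrix F) (by
    rw [Matrix.det_permutation]
    rcases Int.units_eq_one_or (Equiv.Perm.sign σ) with h | h <;> simp [h])

lemma diag_mul_permGL (σ : Equiv.Perm (Fin n)) (t : Fin n → Fˣ) :
    diag t * permGL σ = permGL σ * diag (t ∘ σ.symm) := by
  apply Units.ext
  ext i j
  change (Matrix.diagonal (fun i => (t i : F)) * σ.permMatrix F) i j =
    (σ.permMatrix F * Matrix.diagonal fun i => (t (σ.symm i) : F)) i j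
  rw [Matrix.diagonal_mul, Matrix.mul_diagonal]
  simp only [Equiv.Perm.permMatrix, PEquiv.toMatrix_apply, Equiv.toPEquiv_apply]
  by_cases h : σ i = j
  · subst h; simp
  · simp [h]

lemma permGL_mem_weightSpace (ρ : Representation F (GL (Fin n) F) V) (σ : Equiv.Perm (Fin n))
    {μ : Fin n → ℤ} {w : V} (hw : w ∈ weightSpace ρ μ) :
    ρ (permGL σ) w ∈ weightSpace ρ (μ ∘ σ) := by
  intro t
  rw [← Module.End.mul_apply, ← map_mul, diag_mul_permGL, map_mul, Module.End.mul_apply, hw,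
    map_smul]
  congr 1
  rw [← Equiv.prod_comp σ]
  simp

lemma weightSpace_comp_perm_ne_bot {ρ : Representation F (GL (Fin n) F) V} {μ : Fin n → ℤ}
    (h : weightSpace ρ μ ≠ ⊥) (σ : Equiv.Perm (Fin n)) : weightSpace ρ (μ ∘ σ) ≠ ⊥ := by
  obtain ⟨w, hw, hw0⟩ := (Submodule.ne_bot_iff _).1 h
  refine (Submodule.ne_bot_iff _).2 ⟨_, permGL_mem_weightSpace ρ σ hw, fun h0 => hw0 ?_⟩
  have := congrArg (ρ (permGL σ)⁻¹) h0
  rwa [map_zero, ← Module.End.mul_apply, ← map_mul, inv_mul_cancel, map_one] at this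

lemma subtorus_weight {ρ : Representation F (GL (Fin (n + 1)) F) V} {μ : Fin (n + 1) → ℤ} {w : V}
    (hw : w ∈ weightSpace ρ μ) (s : Fˣ) : ρ (subtorus s) w = (s : F) ^ μ (Fin.last n) • w := by
  rw [subtorus, hw, Fin.prod_univ_castSucc]
  simp

/-- A rational representation generated by a highest weight vector of nonnegative weight is
polynomial. -/
theorem IsRational.isPolynomial_of_borelVec [Infinite F] {d : ℕ}
    {ρ : Representation F (GL (Fin (n + 1)) F) V} (h : IsRational ρ) {wt : Fin (n + 1) → ℤ} {v : V}
    (hv : IsBorelVec ρ wt v) (hwt : ∀ i, 0 ≤ wt i) (hd : ∑ i, wt i = d)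
    (hspan : Submodule.span F (Set.range fun g => ρ g v) = ⊤) : IsPolynomial d ρ := by
  have hlast : ∀ μ, weightSpace ρ μ ≠ ⊥ → 0 ≤ μ (Fin.last n) := fun μ hμ => by
    obtain ⟨w, hw, hw0⟩ := (Submodule.ne_bot_iff _).1 hμ
    obtain ⟨φ, hφ⟩ : ∃ φ : Module.Dual F V, φ w ≠ 0 := by
      by_contra! hc
      exact hw0 ((Module.forall_dual_apply_eq_zero_iff F w).1 hc)
    obtain ⟨q, hq⟩ := h.subtorus_coeff hv hwt hspan w φ
    refine nonneg_of_zpow_mul_eq_eval hφ q fun s => ?_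
    rw [← hq, subtorus_weight hw, map_smul, smul_eq_mul]
  -- Scalar matrices are central, so they act on everything generated by v as they act on v.
  have hscal : ∀ (c : Fˣ) (w : V), ρ (diag fun _ => c) w = (c : F) ^ (d : ℤ) • w := fun c w => by
    have hc : ∀ g : GL (Fin (n + 1)) F, (diag fun _ => c) * g = g * diag fun _ => c := fun g => by
      apply Units.ext
      ext i j
      simp [diag, Matrix.mul_diagonal, Matrix.diagonal_mul, mul_comm]
    have hw : w ∈ Submodule.span F (Set.range fun g => ρ g v) := hspan ▸ Submodule.mem_top
    induction hw using Submodule.span_induction with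
    | mem w hw =>
      obtain ⟨g, rfl⟩ := hw
      rw [← Module.End.mul_apply, ← map_mul, hc, map_mul, Module.End.mul_apply,
        hv _ (Matrix.blockTriangular_diagonal _), map_smul]
      congr 1
      rw [← hd, ← prod_zpow_eq_zpow_sum, borelChar]
      simp [diag]
    | zero => simp
    | add a b _ _ ha hb => rw [map_add, ha, hb, smul_add]
    | smul r a _ ha => rw [map_smul, ha, smul_comm]
  refine ⟨h, fun μ hμ => ⟨fun i => ?_, ?_⟩⟩
  · have := hlast _ (weightSpace_comp_perm_ne_bot hμ (Equiv.swap i (Fin.last n)))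
    simpa using this
  · obtain ⟨w, hw, hw0⟩ := (Submodule.ne_bot_iff _).1 hμ
    refine eq_of_zpow_eq_zpow (F := F) fun s => ?_
    have h1 := hscal s w
    rw [hw, prod_zpow_eq_zpow_sum] at h1
    exact smul_left_injective F hw0 h1

end Weights

/-! ### Weyl modules as quotients of the group algebra. -/

section Weyl

variable {n d : ℕ}

/-- Evaluation of homogeneous polynomial functions at elements of the group algebra. -/
def evalHom (F : Type u) [Field F] (n d : ℕ) :
    F[GL (Fin n) F] →ₗ[F] Module.Dual F (homFun F (Fin n) (Fin n) d) :=
  Finsupp.lift _ F (GL (Fin n) F)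
    (fun g => LinearMap.proj g.val ∘ₗ (homFun F (Fin n) (Fin n) d).subtype) ∘ₗ
      (MonoidAlgebra.coeffLinearEquiv _).toLinearMap

lemma evalHom_single (g : GL (Fin n) F) (r : F) (f : homFun F (Fin n) (Fin n) d) :
    evalHom F n d (MonoidAlgebra.single g r) f = r * f.1 g.val := by
  simp [evalHom]

lemma eq_evalHom (ψ : F[GL (Fin n) F] →ₗ[F] F) (f : homFun F (Fin n) (Fin n) d)
    (h : ∀ g, ψ (MonoidAlgebra.single g 1) = f.1 g.val) (x : F[GL (Fin n) F]) :
    ψ x = evalHom F n d x f := by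
  induction x using MonoidAlgebra.induction_linear with
  | zero => simp
  | add x y hx hy => rw [map_add, map_add, hx, hy, LinearMap.add_apply]
  | single g r =>
    have : MonoidAlgebra.single g r = r • MonoidAlgebra.single g (1 : F) := by simp
    rw [evalHom_single, this, map_smul, h, smul_eq_mul]

variable (J : Submodule (F[GL (Fin n) F]) (F[GL (Fin n) F]))

/-- The representation on the quotient of the group algebra by a left ideal. -/
abbrev quotRep : Representation F (GL (Fin n) F) (F[GL (Fin n) F] ⧸ J) :=
  Representation.ofModule' (k := F) (G := GL (Fin n) F) (F[GL (Fin n) F] ⧸ J)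

lemma quotRep_mk (g : GL (Fin n) F) (x : F[GL (Fin n) F]) :
    quotRep J g (J.mkQ x) = J.mkQ (MonoidAlgebra.single g 1 * x) := rfl

lemma quotRep_mk_one (g : GL (Fin n) F) :
    quotRep J g (J.mkQ 1) = J.mkQ (MonoidAlgebra.single g 1) := by
  rw [quotRep_mk, mul_one]

lemma quotRep_span : Submodule.span F (Set.range fun g => quotRep J g (J.mkQ 1)) = ⊤ := by
  refine eq_top_iff.2 fun v _ => ?_
  obtain ⟨x, rfl⟩ := J.mkQ_surjective v
  induction x using MonoidAlgebra.induction_linear with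
  | zero => simp
  | add x y hx hy => rw [map_add]; exact add_mem (hx trivial) (hy trivial)
  | single g r =>
    have : MonoidAlgebra.single g r = r • MonoidAlgebra.single g (1 : F) := by simp
    rw [this, LinearMap.map_smul_of_tower, ← quotRep_mk_one]
    exact Submodule.smul_mem _ _ (Submodule.subset_span ⟨g, rfl⟩)

variable {J}

lemma quotRep_isBorelVec {wt : Fin n → ℤ} (hJ : ∀ b : GL (Fin n) F, b.val.BlockTriangular id →
      MonoidAlgebra.single b (1 : F) - MonoidAlgebra.single 1 (borelChar wt b) ∈ J) :
    IsBorelVec (quotRep J) wt (J.mkQ 1) := by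
  intro b hb
  rw [quotRep_mk_one, ← LinearMap.map_smul_of_tower, ← sub_eq_zero, ← map_sub]
  have : borelChar wt b • (1 : F[GL (Fin n) F]) = MonoidAlgebra.single 1 (borelChar wt b) := by
    rw [MonoidAlgebra.one_def]; simp
  rw [this]
  exact (Submodule.Quotient.mk_eq_zero J).2 (hJ b hb)

lemma weyl_isBorelVec (wt : Fin n → ℤ) : IsBorelVec (weyl F wt).ρ wt (weylVec wt) :=
  quotRep_isBorelVec fun b hb => (Submodule.mem_sInf).2 fun _ hJ => hJ.1 b hb

lemma weyl_span (wt : Fin n → ℤ) :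
    Submodule.span F (Set.range fun g => (weyl F wt).ρ g (weylVec wt)) = ⊤ :=
  quotRep_span _

/-- Every functional on the quotient, pulled back to the group algebra, is evaluation against a
homogeneous function of degree `d`. -/
lemma mem_of_evalHom_eq_zero [Infinite F] (hJ : HomRep d (quotRep J)) {x : F[GL (Fin n) F]}
    (hx : evalHom F n d x = 0) : x ∈ J := by
  rw [← Submodule.Quotient.mk_eq_zero, ← Module.forall_dual_apply_eq_zero_iff F]
  intro φ
  obtain ⟨f, hf, hfg⟩ := hJ.coeff φ (J.mkQ 1)
  have := eq_evalHom (φ ∘ₗ J.mkQ.restrictScalars F) ⟨f, hf⟩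
    (fun g => by
      change _ = f g.val
      rw [← hfg, quotRep_mk_one]; rfl) x
  rw [hx] at this
  exact this

lemma quotRep_homRep (hJ : ∀ x, evalHom F n d x = 0 → x ∈ J) : HomRep d (quotRep J) := by
  let q : F[GL (Fin n) F] →ₗ[F] (F[GL (Fin n) F] ⧸ J) := J.mkQ.restrictScalars F
  have hq : Function.Surjective q := J.mkQ_surjective
  have hker : LinearMap.ker (evalHom F n d) ≤ LinearMap.ker q := fun x hx =>
    (Submodule.Quotient.mk_eq_zero J).2 (hJ x hx)
  refine ⟨?_, fun ψ v => ?_⟩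
  · have : Module.Finite F (F[GL (Fin n) F] ⧸ LinearMap.ker (evalHom F n d)) :=
      Module.Finite.equiv (LinearMap.quotKerEquivRange (evalHom F n d)).symm
    refine Module.Finite.of_surjective ((LinearMap.ker (evalHom F n d)).liftQ q hker) fun v => ?_
    obtain ⟨x, rfl⟩ := hq v
    exact ⟨Submodule.Quotient.mk x, rfl⟩
  · have h1 : ψ ∘ₗ q ∈ (LinearMap.ker (evalHom F n d)).dualAnnihilator := by
      rw [Submodule.mem_dualAnnihilator]
      intro x hx
      rw [LinearMap.comp_apply, LinearMap.mem_ker.1 (hker hx), map_zero]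
    rw [← LinearMap.range_dualMap_eq_dualAnnihilator_ker] at h1
    obtain ⟨α, hα⟩ := h1
    obtain ⟨f, rfl⟩ := (Module.evalEquiv F (homFun F (Fin n) (Fin n) d)).surjective α
    have h2 : ∀ g, ψ (q (MonoidAlgebra.single g 1)) = f.1 g.val := fun g => by
      have := LinearMap.congr_fun hα (MonoidAlgebra.single g 1)
      rw [LinearMap.dualMap_apply, Module.evalEquiv_apply, Module.Dual.eval_apply, evalHom_single,
        one_mul] at this
      exact this.symm
    obtain ⟨x, rfl⟩ := hq v
    induction x using MonoidAlgebra.induction_linear with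
    | zero => exact ⟨0, zero_mem _, fun g => by simp⟩
    | add x y hx hy =>
      obtain ⟨a, ha, hag⟩ := hx
      obtain ⟨b, hb, hbg⟩ := hy
      exact ⟨a + b, add_mem ha hb, fun g => by simp [hag, hbg]⟩
    | single h r =>
      refine ⟨r • fun x => f.1 (x * h.val),
        Submodule.smul_mem _ _ (homFun_comp_mul_right f.2 h.val), fun g => ?_⟩
      have h3 : quotRep J g (q (MonoidAlgebra.single h r)) =
          r • q (MonoidAlgebra.single (g * h) 1) := by
        rw [← map_smul]
        change J.mkQ (MonoidAlgebra.single g 1 * MonoidAlgebra.single h r) = J.mkQ _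
        simp
      rw [h3, map_smul, h2]
      rfl

/-- Every ideal in the intersection defining `weylIdeal` has a polynomial quotient of degree `d`,
hence contains the kernel of `evalHom`. So does the intersection, and this one bound makes Δ(λ)
finite-dimensional and polynomial. -/
theorem weyl_homRep [IsAlgClosed F] {wt : Fin (n + 1) → ℤ} (hwt : ∀ i, 0 ≤ wt i)
    (hd : ∑ i, wt i = d) : HomRep d (weyl F wt).ρ :=
  quotRep_homRep fun _ hx => (Submodule.mem_sInf).2 fun J hJ =>
    mem_of_evalHom_eq_zero (hJ.2.isPolynomial_of_borelVec (quotRep_isBorelVec hJ.1) hwt hd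
      (quotRep_span J)).homRep hx

theorem irr_homRep [IsAlgClosed F] {wt : Fin (n + 1) → ℤ} (hwt : ∀ i, 0 ≤ wt i)
    (hd : ∑ i, wt i = d) : HomRep d (irr F wt).ρ := by
  let q : WeylMod F wt →ₗ[F] (WeylMod F wt ⧸ weylRad (F := F) wt) :=
    (weylRad wt).mkQ.restrictScalars F
  exact HomRep.of_surjective (weyl_homRep hwt hd) q (fun _ _ => rfl)
    (Submodule.mkQ_surjective (weylRad (F := F) wt))

end Weyl

/-! ### The right adjoint section of `τ` on objects -/

section Coind

open Matrix

variable {n d : ℕ}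

variable (F n) in
/-- The `n × (n+1)` matrix `(1 | 0)`. -/
def topRow : Matrix (Fin n) (Fin (n + 1)) F :=
  (1 : Matrix (Fin (n + 1)) _ F).submatrix Fin.castSucc id

variable (F n) in
/-- The transpose of `(1 | 0)`. -/
def leftCol : Matrix (Fin (n + 1)) (Fin n) F :=
  (1 : Matrix (Fin (n + 1)) _ F).submatrix id Fin.castSucc

lemma mul_leftCol {m : Type*} (x : Matrix m (Fin (n + 1)) F) :
    x * leftCol F n = x.submatrix id Fin.castSucc := by
  ext i j
  simp [leftCol, Matrix.mul_apply, Matrix.one_apply]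

lemma topRow_mul {m : Type*} (x : Matrix (Fin (n + 1)) m F) :
    topRow F n * x = x.submatrix Fin.castSucc id := by
  ext i j
  simp [topRow, Matrix.mul_apply, Matrix.one_apply]

lemma topRow_mul_leftCol : topRow F n * leftCol F n = 1 := by
  rw [mul_leftCol, topRow, Matrix.submatrix_submatrix]
  exact Matrix.submatrix_one _ (Fin.castSucc_injective n)

lemma mul_topRow_castSucc {m : Type*} (x : Matrix m (Fin n) F) (i : m) (j : Fin n) :
    (x * topRow F n) i j.castSucc = x i j := by
  simp [topRow, Matrix.mul_apply, Matrix.one_apply]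

lemma mul_topRow_last {m : Type*} (x : Matrix m (Fin n) F) (i : m) :
    (x * topRow F n) i (Fin.last n) = 0 := by
  simp [topRow, Matrix.mul_apply]

lemma leftCol_mul_castSucc {m : Type*} (x : Matrix (Fin n) m F) (i : Fin n) (j : m) :
    (leftCol F n * x) i.castSucc j = x i j := by
  simp [leftCol, Matrix.mul_apply, Matrix.one_apply]

lemma leftCol_mul_last {m : Type*} (x : Matrix (Fin n) m F) (j : m) :
    (leftCol F n * x) (Fin.last n) j = 0 := by
  have : ∀ i : Fin n, Fin.last n ≠ i.castSucc := fun i => (Fin.castSucc_lt_last i).ne'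
  simp [leftCol, Matrix.mul_apply, this]

lemma leftCol_mul_topRow : leftCol F n * topRow F n = corner 1 := by
  ext i j
  refine Fin.lastCases ?_ (fun j => ?_) j <;> refine Fin.lastCases ?_ (fun i => ?_) i <;>
    simp [mul_topRow_last, mul_topRow_castSucc, corner, blk_castSucc_castSucc, blk_castSucc_last,
      blk_last_castSucc, blk_last_last, leftCol, Matrix.one_apply]
  exact (Fin.castSucc_lt_last _).ne'

lemma topRow_mul_blk (a : Matrix (Fin n) (Fin n) F) (y : Matrix (Fin 1) (Fin n) F)
    (t : Matrix (Fin 1) (Fin 1) F) : topRow F n * blk a 0 y t = a * topRow F n := by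
  ext i j
  rw [topRow_mul]
  refine Fin.lastCases ?_ (fun j => ?_) j <;>
    simp [mul_topRow_last, mul_topRow_castSucc, blk_castSucc_castSucc, blk_castSucc_last]

lemma blk_mul_leftCol (a : Matrix (Fin n) (Fin n) F) (z : Matrix (Fin n) (Fin 1) F)
    (t : Matrix (Fin 1) (Fin 1) F) : blk a z 0 t * leftCol F n = leftCol F n * a := by
  ext i j
  rw [mul_leftCol]
  refine Fin.lastCases ?_ (fun i => ?_) i <;>
    simp [leftCol_mul_last, leftCol_mul_castSucc, blk_castSucc_castSucc, blk_last_castSucc]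

variable {V : Type*} [AddCommGroup V] [Module F V] {σ : Representation F (GL (Fin n) F) V}
  [Infinite F]

/-- Homogeneous polynomial maps `f` from `n × (n+1)` matrices to `V` with `f (a x) = a f(x)`. -/
def coind (h : HomRep d σ) : Submodule F (Matrix (Fin n) (Fin (n + 1)) F → V) where
  carrier := {f | (∀ φ : Module.Dual F V, (fun x => φ (f x)) ∈ homFun F (Fin n) (Fin (n + 1)) d) ∧
    ∀ a x, f (a * x) = h.mat a (f x)}
  add_mem' := by
    rintro f f' ⟨hf, hf2⟩ ⟨hf', hf2'⟩
    refine ⟨fun φ => ?_, fun a x => by simp [hf2, hf2']⟩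
    simp only [Pi.add_apply, map_add]
    exact add_mem (hf φ) (hf' φ)
  zero_mem' := ⟨fun φ => by
    simp only [Pi.zero_apply, map_zero]; exact zero_mem _, fun a x => by simp⟩
  smul_mem' := by
    rintro c f ⟨hf, hf2⟩
    refine ⟨fun φ => ?_, fun a x => by simp [hf2]⟩
    simp only [Pi.smul_apply, map_smul]
    exact Submodule.smul_mem _ c (hf φ)

/-- The action of `GL_{n+1}` on `coind` by right translations. -/
def coindRep (h : HomRep d σ) : Representation F (GL (Fin (n + 1)) F) (coind h) where
  toFun g :=
    { toFun := fun f => ⟨fun x => f.1 (x * g.val),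
        fun φ => homFun_comp_mul_right (f.2.1 φ) g.val,
        fun a x => by beta_reduce; rw [Matrix.mul_assoc, f.2.2]⟩
      map_add' := fun _ _ => rfl
      map_smul' := fun _ _ => rfl }
  map_one' := by
    ext f x
    simp
  map_mul' g g' := by
    ext f x
    simp [Matrix.mul_assoc]

lemma coindRep_apply (h : HomRep d σ) (g : GL (Fin (n + 1)) F) (f : coind h)
    (x : Matrix (Fin n) (Fin (n + 1)) F) : (coindRep h g f).1 x = f.1 (x * g.val) := rfl

lemma coind_finite (h : HomRep d σ) : Module.Finite F (coind h) := by
  have := h.finite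
  let b := Module.finBasis F V
  let L : coind h →ₗ[F] (Fin (Module.finrank F V) → homFun F (Fin n) (Fin (n + 1)) d) :=
    { toFun := fun f i => ⟨fun x => b.coord i (f.1 x), f.2.1 _⟩
      map_add' := fun f f' => by ext i x; simp
      map_smul' := fun c f => by ext i x; simp }
  refine Module.Finite.of_injective L fun f f' hff => Subtype.ext (funext fun x => ?_)
  refine b.ext_elem fun i => ?_
  exact congrFun (congrArg Subtype.val (congrFun hff i)) x

lemma coind_homRep (h : HomRep d σ) : HomRep d (coindRep h) := by
  let ev : Matrix (Fin n) (Fin (n + 1)) F → coind h →ₗ[F] V := fun x =>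
    LinearMap.proj x ∘ₗ (coind h).subtype
  refine .of_separating (coind_finite h) {φ | ∃ x ψ, φ = ψ ∘ₗ ev x} (fun f hf => ?_) ?_
  · refine Subtype.ext (funext fun x => ?_)
    exact (Module.forall_dual_apply_eq_zero_iff F _).1 fun ψ => hf _ ⟨x, ψ, rfl⟩
  · rintro _ ⟨x, ψ, rfl⟩ f
    exact ⟨_, homFun_comp_mul_left (f.2.1 ψ) x, fun g => rfl⟩

lemma coind_mat (h : HomRep d σ) (A : Matrix (Fin (n + 1)) (Fin (n + 1)) F) (f : coind h)
    (x : Matrix (Fin n) (Fin (n + 1)) F) :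
    ((coind_homRep h).mat A f).1 x = f.1 (x * A) :=
  eq_of_GL (fun A => ((coind_homRep h).mat A f).1 x) (fun A => f.1 (x * A))
    (fun φ => (coind_homRep h).mat_coeff (φ ∘ₗ LinearMap.proj x ∘ₗ (coind h).subtype) f)
    (fun φ => homFun_comp_mul_left (f.2.1 φ) x)
    (fun g => by rw [(coind_homRep h).mat_GL, coindRep_apply]) A

/-- The element `x ↦ (x (1|0)ᵀ) w` of `coind`. -/
def coindElt (h : HomRep d σ) (w : V) : coind h :=
  ⟨fun x => h.mat (x * leftCol F n) w,
    fun φ => homFun_comp_mul_right (h.mat_coeff φ w) (leftCol F n),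
    fun a x => by beta_reduce; rw [Matrix.mul_assoc, h.mat_mul]⟩

/-- Evaluation at `(1 | 0)`. -/
def coindEval (h : HomRep d σ) : coind h →ₗ[F] V :=
  LinearMap.proj (topRow F n) ∘ₗ (coind h).subtype

lemma coindEval_elt (h : HomRep d σ) (w : V) : coindEval h (coindElt h w) = w := by
  change h.mat (topRow F n * leftCol F n) w = w
  rw [topRow_mul_leftCol, map_one, Module.End.one_apply]

lemma coindEval_embed (h : HomRep d σ) (g : GL (Fin n) F) (f : coind h) :
    coindEval h (coindRep h (embed g) f) = σ g (coindEval h f) := by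
  change f.1 (topRow F n * (embed g).val) = σ g (f.1 (topRow F n))
  rw [embed_val, topRow_mul_blk, f.2.2, h.mat_GL]

lemma coindElt_mem_invariants (h : HomRep d σ) (w : V) :
    coindElt h w ∈ invariants (coindRep h) := by
  intro s
  refine Subtype.ext (funext fun x => ?_)
  change h.mat (x * (subtorus s).val * leftCol F n) w = h.mat (x * leftCol F n) w
  rw [Matrix.mul_assoc, subtorus_val, blk_mul_leftCol, Matrix.mul_one]

/-- An invariant f satisfies f(x) = f(x e), and e = (1|0)ᵀ(1|0), so equivariance expresses f(x)
through the value of f at (1|0). -/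
lemma coindEval_injOn (h : HomRep d σ) {f : coind h} (hf : f ∈ invariants (coindRep h))
    (h0 : coindEval h f = 0) : f = 0 := by
  refine Subtype.ext (funext fun x => ?_)
  rw [← ((coind_homRep h).mem_invariants_iff f).1 hf, coind_mat, ← leftCol_mul_topRow,
    ← Matrix.mul_assoc, f.2.2]
  change h.mat _ (coindEval h f) = 0
  rw [h0, map_zero]

/-- An upper triangular b with upper left block a satisfies b (1|0)ᵀ = (1|0)ᵀ a, so b acts on the
element through a. This lets Δ(λ,0) map to the coinduced module. -/
lemma coindElt_isBorelVec (h : HomRep d σ) {wt : Fin n → ℤ} {w : V} (hw : IsBorelVec σ wt w) :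
    IsBorelVec (coindRep h) (Fin.snoc wt 0 : Fin (n + 1) → ℤ) (coindElt h w) := by
  intro b hb
  obtain ⟨a, z, y, t, hx⟩ := exists_eq_blk b.val
  have hy : y = 0 := by
    ext i j
    obtain rfl := Subsingleton.elim i 0
    rw [← blk_last_castSucc a z y t, ← hx]
    exact hb (Fin.castSucc_lt_last j)
  subst hy
  have hdet : b.val.det = a.det * t.det := by
    rw [hx]; simp [blk, Matrix.det_fromBlocks_zero₂₁]
  have ha : a.det ≠ 0 := fun h0 => (b.isUnit.map Matrix.detMonoidHom).ne_zero
    (hdet.trans (by rw [h0, zero_mul]))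
  have hbt : a.BlockTriangular id := fun i j hij => by
    rw [← blk_castSucc_castSucc a z 0 t, ← hx]
    exact hb (by simpa using hij)
  have h1 := hw (Matrix.GeneralLinearGroup.mkOfDetNeZero a ha) hbt
  have h2 : borelChar (Fin.snoc wt 0 : Fin (n + 1) → ℤ) b =
      borelChar wt (Matrix.GeneralLinearGroup.mkOfDetNeZero a ha) := by
    rw [borelChar_of_blk _ hx]
    simp [borelChar, Matrix.GeneralLinearGroup.mkOfDetNeZero]
  refine Subtype.ext (funext fun x => ?_)
  change h.mat (x * b.val * leftCol F n) w =
    borelChar (Fin.snoc wt 0 : Fin (n + 1) → ℤ) b • h.mat (x * leftCol F n) w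
  rw [Matrix.mul_assoc, hx, blk_mul_leftCol, ← Matrix.mul_assoc, h.mat_mul, h2, ← map_smul, ← h1,
    ← h.mat_GL]
  rfl

/-- Evaluation at (1|0) identifies the invariants of the coinduced module of N with N. -/
lemma tau_essSurj [IsAlgClosed F] : (tau F n d).EssSurj where
  mem_essImage N := by
    let h := N.homRep
    let M : PolRep F (n + 1) d := ⟨Rep.of (coindRep h), (coind_homRep h).isPolynomial⟩
    refine ⟨M, ⟨polIso (LinearEquiv.ofBijective
      (coindEval h ∘ₗ (invariants (coindRep h)).subtype) ⟨?_, fun w => ?_⟩) fun g v => ?_⟩⟩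
    · refine (injective_iff_map_eq_zero _).2 fun f hf => Subtype.ext ?_
      exact coindEval_injOn h f.2 hf
    · exact ⟨⟨_, coindElt_mem_invariants h w⟩, coindEval_elt h w⟩
    · exact coindEval_embed h g v.1

end Coind

/-! ### Weyl modules and irreducible modules under `τ` -/

lemma exists_equiv_of_ker_eq {A B C : Type*} [AddCommGroup A] [Module F A] [AddCommGroup B]
    [Module F B] [AddCommGroup C] [Module F C] (p : A →ₗ[F] B) (q : A →ₗ[F] C)
    (hp : Function.Surjective p) (hq : Function.Surjective q)
    (hpq : LinearMap.ker p = LinearMap.ker q) : ∃ e : B ≃ₗ[F] C, ∀ a, e (p a) = q a := by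
  refine ⟨(p.quotKerEquivOfSurjective hp).symm ≪≫ₗ Submodule.quotEquivOfEq _ _ hpq ≪≫ₗ
    q.quotKerEquivOfSurjective hq, fun a => ?_⟩
  have : (p.quotKerEquivOfSurjective hp).symm (p a) = Submodule.Quotient.mk a := by
    rw [LinearEquiv.symm_apply_eq]; rfl
  simp only [LinearEquiv.trans_apply, this]
  rfl

section WeylTau

variable [IsAlgClosed F] {n d : ℕ} {wt : Fin (n + 1) → ℤ}

/-- The weight `(λ, 0)`. -/
abbrev addZero {m : ℕ} (wt : Fin m → ℤ) : Fin (m + 1) → ℤ := Fin.snoc wt 0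

lemma addZero_nonneg (hwt : ∀ i, 0 ≤ wt i) (i : Fin (n + 2)) : 0 ≤ addZero wt i := by
  refine Fin.lastCases ?_ (fun i => ?_) i
  · simp
  · simpa using hwt i

lemma sum_addZero (hd : ∑ i, wt i = d) : ∑ i, addZero wt i = d := by
  rw [Fin.sum_univ_castSucc]; simpa using hd

variable (F) in
omit [IsAlgClosed F] in
lemma weylVec_mem_invariants (wt : Fin (n + 1) → ℤ) :
    weylVec (addZero wt) ∈ invariants (weyl F (addZero wt)).ρ := fun s => by
  rw [(weyl_isBorelVec (addZero wt)).subtorus s]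
  simp

variable (F) in
/-- The highest weight vector of `Δ(λ,0)` as an `S`-invariant. -/
def invVec (wt : Fin (n + 1) → ℤ) : invariants (weyl F (addZero wt)).ρ :=
  ⟨weylVec (addZero wt), weylVec_mem_invariants F wt⟩

omit [IsAlgClosed F] in
lemma invVec_isBorelVec : IsBorelVec (invRep (weyl F (addZero wt)).ρ) wt (invVec F wt) := by
  intro b hb
  apply Subtype.ext
  rw [invRep_coe]
  refine (weyl_isBorelVec (addZero wt) (embed b) ?_).trans ?_
  · rw [embed_val]; exact blk_blockTriangular hb 0 1
  · rw [borelChar_of_blk _ (embed_val b)]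
    simp [borelChar]
    rfl

lemma exists_weyl_hom (hwt : ∀ i, 0 ≤ wt i) (hd : ∑ i, wt i = d) :
    ∃ θ : WeylMod F wt →ₗ[F] invariants (weyl F (addZero wt)).ρ, θ (weylVec wt) = invVec F wt ∧
      ∀ g x, θ ((weyl F wt).ρ g x) = invRep (weyl F (addZero wt)).ρ g (θ x) := by
  have h' : HomRep d (weyl F (addZero wt)).ρ := weyl_homRep (addZero_nonneg hwt) (sum_addZero hd)
  obtain ⟨f, hf⟩ := (weyl_universal wt (Rep.of (invRep (weyl F (addZero wt)).ρ))
    h'.invRep.isPolynomial.rational (invVec F wt) invVec_isBorelVec).exists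
  exact ⟨f.hom.toLinearMap, hf, fun g x => Rep.hom_comm_apply f g x⟩

variable {θ : WeylMod F wt →ₗ[F] invariants (weyl F (addZero wt)).ρ}

/-- The composite Δ(λ) → Δ(λ,0)^S → coind Δ(λ) → Δ(λ) is equivariant and fixes the generator, so it
is the identity. -/
lemma weyl_hom_injective (hwt : ∀ i, 0 ≤ wt i) (hd : ∑ i, wt i = d)
    (hv : θ (weylVec wt) = invVec F wt)
    (hθ : ∀ g x, θ ((weyl F wt).ρ g x) = invRep (weyl F (addZero wt)).ρ g (θ x)) :
    Function.Injective θ := by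
  have h : HomRep d (weyl F wt).ρ := weyl_homRep hwt hd
  obtain ⟨f, hf⟩ := (weyl_universal (addZero wt) (Rep.of (coindRep h))
    (coind_homRep h).isPolynomial.rational (coindElt h (weylVec wt))
    (coindElt_isBorelVec h (weyl_isBorelVec wt))).exists
  let c : WeylMod F wt →ₗ[F] WeylMod F wt := coindEval h ∘ₗ f.hom.toLinearMap ∘ₗ
    (invariants (weyl F (addZero wt)).ρ).subtype ∘ₗ θ
  have hcv : c (weylVec wt) = weylVec wt := by
    change coindEval h (f.hom (θ (weylVec wt)).1) = _
    rw [hv]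
    exact (congrArg _ hf).trans (coindEval_elt h _)
  have hc : ∀ g x, c ((weyl F wt).ρ g x) = (weyl F wt).ρ g (c x) := fun g x => by
    change coindEval h (f.hom (θ ((weyl F wt).ρ g x)).1) = _
    rw [hθ, invRep_coe]
    exact (congrArg _ (Rep.hom_comm_apply f (embed g) (θ x).1)).trans (coindEval_embed h g _)
  have hid : c = LinearMap.id := by
    refine LinearMap.ext_on (weyl_span wt) ?_
    rintro _ ⟨g, rfl⟩
    exact (hc g _).trans (congrArg _ hcv)
  refine Function.LeftInverse.injective
    (g := fun y => coindEval h (f.hom.toLinearMap y.1)) fun x => ?_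
  exact LinearMap.congr_fun hid x

/-- The invariants are spanned by the vectors e g v. On the dense cell g = p b one has e p = `embed
a` · e, so e g v is a multiple of θ(a v_λ). -/
lemma weyl_hom_surjective (hwt : ∀ i, 0 ≤ wt i) (hd : ∑ i, wt i = d)
    (hv : θ (weylVec wt) = invVec F wt)
    (hθ : ∀ g x, θ ((weyl F wt).ρ g x) = invRep (weyl F (addZero wt)).ρ g (θ x)) :
    Function.Surjective θ := by
  have h' : HomRep d (weyl F (addZero wt)).ρ := weyl_homRep (addZero_nonneg hwt) (sum_addZero hd)
  let W : Submodule F (WeylMod F (addZero wt)) :=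
    (LinearMap.range θ).map (invariants (weyl F (addZero wt)).ρ).subtype
  have hW : W.comap (h'.mat (corner 1)) = ⊤ := by
    rw [eq_top_iff, ← weyl_span, Submodule.span_le]
    rintro _ ⟨g, rfl⟩
    refine h'.isPolynomial.rational.mem_of_dense _ _ (fun g hg => ?_) g
    obtain ⟨a, z, y, t, p, b, rfl, hp, hb⟩ := exists_block_decomposition g hg
    rw [map_mul, Module.End.mul_apply, weyl_isBorelVec (addZero wt) b
      (by rw [hb]; exact blk_blockTriangular Matrix.blockTriangular_one _ _), map_smul]
    refine Submodule.smul_mem _ _ ?_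
    rw [Submodule.mem_comap, ← h'.mat_GL, ← h'.mat_mul]
    have hcp : corner 1 * p.val = (embed a).val * corner 1 := by
      rw [hp, embed_val]; simp [corner, blk_mul]
    rw [hcp, h'.mat_mul, (h'.mem_invariants_iff _).1 (weylVec_mem_invariants F wt), h'.mat_GL]
    refine ⟨_, ⟨(weyl F wt).ρ a (weylVec wt), rfl⟩, ?_⟩
    rw [hθ, hv]
    rfl
  intro y
  have hy : y.1 ∈ W.comap (h'.mat (corner 1)) := hW ▸ Submodule.mem_top
  rw [Submodule.mem_comap, (h'.mem_invariants_iff _).1 y.2] at hy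
  obtain ⟨_, ⟨x, rfl⟩, hx⟩ := hy
  exact ⟨x, Subtype.ext hx⟩

/-- Submodules over the group algebra are stable under the extension to all matrices. -/
lemma weyl_mat_mem {m : ℕ} {wt : Fin m → ℤ} (h : HomRep d (weyl F wt).ρ)
    (N : Submodule (F[GL (Fin m) F]) (WeylMod F wt)) {x : WeylMod F wt} (hx : x ∈ N)
    (A : Matrix (Fin m) (Fin m) F) : h.mat A x ∈ N :=
  h.mat_mem (N.restrictScalars F) x (fun g => N.smul_mem (MonoidAlgebra.single g 1) hx) A

/-- Submodules are moved both ways along θ: N' goes to its preimage under θ, and N to the largest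
submodule whose image under e lies in θ(N). Both operations preserve avoidance of the highest weight
vector, because θ is injective and matches the two vectors. -/
lemma mem_weylRad_iff (hwt : ∀ i, 0 ≤ wt i) (hd : ∑ i, wt i = d)
    (hv : θ (weylVec wt) = invVec F wt)
    (hθ : ∀ g x, θ ((weyl F wt).ρ g x) = invRep (weyl F (addZero wt)).ρ g (θ x))
    (x : WeylMod F wt) : (θ x).1 ∈ weylRad (F := F) (addZero wt) ↔ x ∈ weylRad (F := F) wt := by
  have h : HomRep d (weyl F wt).ρ := weyl_homRep hwt hd
  have h' : HomRep d (weyl F (addZero wt)).ρ := weyl_homRep (addZero_nonneg hwt) (sum_addZero hd)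
  have hinj := weyl_hom_injective hwt hd hv hθ
  have hsurj := weyl_hom_surjective hwt hd hv hθ
  constructor
  · let R : Submodule F (WeylMod F (addZero wt)) :=
      ((weylRad (F := F) wt).restrictScalars F |>.map θ).map
        (invariants (weyl F (addZero wt)).ρ).subtype
    -- The largest submodule that e sends into the image of the radical of Δ(λ).
    let T : Submodule (F[GL (Fin (n + 2)) F]) (WeylMod F (addZero wt)) :=
      MonoidAlgebra.submoduleOfSMulMem
        (⨅ g, (R.comap (h'.mat (corner 1))).comap ((weyl F (addZero wt)).ρ g)) (fun g y hy => by
          simp only [Submodule.mem_iInf, Submodule.mem_comap] at hy ⊢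
          intro g'
          have h1 := hy (g' * g)
          rw [map_mul] at h1
          exact h1)
    have hT : weylRad (F := F) (addZero wt) ≤ T := by
      refine sSup_le fun N' hN' y hy => ?_
      refine (Submodule.mem_iInf _).2 fun g => ?_
      have hy1 : (weyl F (addZero wt)).ρ g y ∈ N' := N'.smul_mem (MonoidAlgebra.single g 1) hy
      have hy2 := weyl_mat_mem h' N' hy1 (corner 1)
      obtain ⟨x, hx⟩ := hsurj ⟨_, h'.corner_mem_invariants 1 ((weyl F (addZero wt)).ρ g y)⟩
      let N : Submodule (F[GL (Fin (n + 1)) F]) (WeylMod F wt) :=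
        MonoidAlgebra.submoduleOfSMulMem
          (((N'.restrictScalars F).comap (invariants (weyl F (addZero wt)).ρ).subtype).comap θ)
          (fun g x hx => by
            have h2 := hθ g x
            change (θ ((weyl F wt).ρ g x)).1 ∈ N'
            rw [h2]
            exact N'.smul_mem (MonoidAlgebra.single (embed g) 1) hx)
      have hN : weylVec wt ∉ N := fun hc => hN' (by
        have hc' : (θ (weylVec wt)).1 ∈ N' := hc
        rw [hv] at hc'
        exact hc')
      have hxN : x ∈ N := by
        change (θ x).1 ∈ N'
        rw [hx]
        exact hy2
      have hxR : x ∈ weylRad (F := F) wt := le_sSup (a := N) hN hxN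
      exact ⟨_, ⟨x, hxR, rfl⟩, congrArg Subtype.val hx⟩
    intro hx
    have h1 := (Submodule.mem_iInf _).1 (hT hx) 1
    rw [map_one, Submodule.mem_comap, Module.End.one_apply, Submodule.mem_comap,
      (h'.mem_invariants_iff _).1 (θ x).2] at h1
    obtain ⟨_, ⟨x', hx', rfl⟩, hxx⟩ := h1
    rw [← hinj (Subtype.ext hxx)]
    exact hx'
  · let T : Submodule (F[GL (Fin (n + 1)) F]) (WeylMod F wt) :=
      MonoidAlgebra.submoduleOfSMulMem
        ((((weylRad (F := F) (addZero wt)).restrictScalars F).comap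
          (invariants (weyl F (addZero wt)).ρ).subtype).comap θ)
        (fun g x hx => by
          have h2 := hθ g x
          change (θ ((weyl F wt).ρ g x)).1 ∈ weylRad (F := F) (addZero wt)
          rw [h2]
          exact (weylRad (F := F) (addZero wt)).smul_mem (MonoidAlgebra.single (embed g) 1) hx)
    suffices hT : weylRad (F := F) wt ≤ T from fun hx => hT hx
    refine sSup_le fun N hN x hx => ?_
    let K : Submodule F (WeylMod F (addZero wt)) :=
      ((N.restrictScalars F).map θ).map (invariants (weyl F (addZero wt)).ρ).subtype
    let N' : Submodule (F[GL (Fin (n + 2)) F]) (WeylMod F (addZero wt)) :=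
      MonoidAlgebra.submoduleOfSMulMem
        (⨅ g, (K.comap (h'.mat (corner 1))).comap ((weyl F (addZero wt)).ρ g)) (fun g y hy => by
          simp only [Submodule.mem_iInf, Submodule.mem_comap] at hy ⊢
          intro g'
          have h1 := hy (g' * g)
          rw [map_mul] at h1
          exact h1)
    have hN' : weylVec (addZero wt) ∉ N' := fun hc => hN (by
      have h1 := (Submodule.mem_iInf _).1 hc 1
      rw [map_one, Submodule.mem_comap, Module.End.one_apply, Submodule.mem_comap,
        (h'.mem_invariants_iff _).1 (weylVec_mem_invariants F wt)] at h1
      obtain ⟨_, ⟨x', hx', rfl⟩, hxx⟩ := h1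
      have h2 : θ x' = θ (weylVec wt) := by
        rw [hv]
        exact Subtype.ext hxx
      rw [← hinj h2]
      exact hx')
    have hxN : (θ x).1 ∈ N' := by
      refine (Submodule.mem_iInf _).2 fun g => ?_
      rw [Submodule.mem_comap, Submodule.mem_comap]
      -- Since e g e = `corner a`, one gets e g θ(x) = θ(a x), and a x stays in `N` even when a is
      -- singular.
      obtain ⟨a, ha⟩ := exists_corner_mul_mul_corner g.val
      have h1 : h'.mat (corner 1) ((weyl F (addZero wt)).ρ g (θ x).1) = (θ (h.mat a x)).1 := by
        rw [h.mat_map h'.invRep θ hθ, h'.invRep_mat, ← ha, h'.mat_mul,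
          (h'.mem_invariants_iff _).1 (θ x).2, h'.mat_mul, h'.mat_GL]
      rw [h1]
      exact ⟨_, ⟨_, weyl_mat_mem h N hx a, rfl⟩, rfl⟩
    exact le_sSup (a := N') hN' hxN

theorem tau_weyl (hwt : ∀ i, 0 ≤ wt i) (hd : ∑ i, wt i = d) :
    ∃ (h : polProp F (n + 2) d (weyl F (addZero wt))) (h' : polProp F (n + 1) d (weyl F wt)),
      Nonempty ((tau F (n + 1) d).obj ⟨_, h⟩ ≅ ⟨_, h'⟩) := by
  refine ⟨(weyl_homRep (addZero_nonneg hwt) (sum_addZero hd)).isPolynomial,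
    (weyl_homRep hwt hd).isPolynomial, ?_⟩
  obtain ⟨θ, hv, hθ⟩ := exists_weyl_hom (F := F) hwt hd
  exact ⟨(polIso (LinearEquiv.ofBijective θ ⟨weyl_hom_injective hwt hd hv hθ,
    weyl_hom_surjective hwt hd hv hθ⟩) hθ).symm⟩

/-- Applying e to a preimage shows that Δ(λ,0)^S → L(λ,0)^S is onto; composed with θ it has the
radical of Δ(λ) as kernel. -/
lemma exists_irr_equiv (hwt : ∀ i, 0 ≤ wt i) (hd : ∑ i, wt i = d)
    (h' : HomRep d (weyl F (addZero wt)).ρ) (hi' : HomRep d (irr F (addZero wt)).ρ) :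
    ∃ e : (WeylMod F wt ⧸ weylRad (F := F) wt) ≃ₗ[F] invariants (irr F (addZero wt)).ρ,
      ∀ g v, e ((irr F wt).ρ g v) = invRep (irr F (addZero wt)).ρ g (e v) := by
  obtain ⟨θ, hv, hθ⟩ := exists_weyl_hom (F := F) hwt hd
  let p : WeylMod F wt →ₗ[F] (WeylMod F wt ⧸ weylRad (F := F) wt) :=
    (weylRad (F := F) wt).mkQ.restrictScalars F
  let p' : WeylMod F (addZero wt) →ₗ[F]
      (WeylMod F (addZero wt) ⧸ weylRad (F := F) (addZero wt)) :=
    (weylRad (F := F) (addZero wt)).mkQ.restrictScalars F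
  have hp' : ∀ g y, p' ((weyl F (addZero wt)).ρ g y) = (irr F (addZero wt)).ρ g (p' y) :=
    fun _ _ => rfl
  let r : invariants (weyl F (addZero wt)).ρ →ₗ[F] invariants (irr F (addZero wt)).ρ :=
    p'.restrict fun y hy s => by rw [← hp', hy s]
  have hr : Function.Surjective r := fun y => by
    obtain ⟨z, hz⟩ := Submodule.mkQ_surjective (weylRad (F := F) (addZero wt)) y.1
    refine ⟨⟨_, h'.corner_mem_invariants 1 z⟩, Subtype.ext ?_⟩
    change p' (h'.mat (corner 1) z) = y.1
    rw [h'.mat_map hi' p' hp']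
    refine Eq.trans ?_ ((hi'.mem_invariants_iff _).1 y.2)
    exact congrArg _ hz
  have hp : Function.Surjective p := Submodule.mkQ_surjective (weylRad (F := F) wt)
  have hker : LinearMap.ker p = LinearMap.ker (r ∘ₗ θ) := by
    ext x
    have h1 : p x = 0 ↔ x ∈ weylRad (F := F) wt :=
      Submodule.Quotient.mk_eq_zero (weylRad (F := F) wt)
    have h2 : p' (θ x).1 = 0 ↔ (θ x).1 ∈ weylRad (F := F) (addZero wt) :=
      Submodule.Quotient.mk_eq_zero (weylRad (F := F) (addZero wt))
    rw [LinearMap.mem_ker, LinearMap.mem_ker, h1, ← mem_weylRad_iff hwt hd hv hθ x, ← h2]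
    exact ⟨fun h0 => Subtype.ext h0, fun h0 => congrArg Subtype.val h0⟩
  obtain ⟨e, he⟩ := exists_equiv_of_ker_eq p (r ∘ₗ θ) hp
    (hr.comp (weyl_hom_surjective hwt hd hv hθ)) hker
  refine ⟨e, fun g v => ?_⟩
  obtain ⟨x, rfl⟩ := hp v
  change e (p ((weyl F wt).ρ g x)) = invRep (irr F (addZero wt)).ρ g (e (p x))
  rw [he, he, LinearMap.comp_apply, hθ]
  exact Subtype.ext (hp' (embed g) (θ x).1)

theorem tau_irr (hwt : ∀ i, 0 ≤ wt i) (hd : ∑ i, wt i = d) :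
    ∃ (h : polProp F (n + 2) d (irr F (addZero wt))) (h' : polProp F (n + 1) d (irr F wt)),
      Nonempty ((tau F (n + 1) d).obj ⟨_, h⟩ ≅ ⟨_, h'⟩) := by
  have h' : HomRep d (weyl F (addZero wt)).ρ := weyl_homRep (addZero_nonneg hwt) (sum_addZero hd)
  have hi' : HomRep d (irr F (addZero wt)).ρ := irr_homRep (addZero_nonneg hwt) (sum_addZero hd)
  obtain ⟨e, he⟩ := exists_irr_equiv hwt hd h' hi'
  let M : PolRep F (n + 2) d := ⟨irr F (addZero wt), hi'.isPolynomial⟩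
  let N : PolRep F (n + 1) d := ⟨irr F wt, (irr_homRep hwt hd).isPolynomial⟩
  have : N ≅ (tau F (n + 1) d).obj M := polIso e he
  exact ⟨M.property, N.property, ⟨this.symm⟩⟩

end WeylTau

/-! ### The equivalence for `d ≤ n` -/

section Equivalence

variable [IsAlgClosed F] {n d : ℕ} {V : Type*} [AddCommGroup V] [Module F V]
  {ρ : Representation F (GL (Fin (n + 1)) F) V}

/-- For `d ≤ n` every weight of degree `d` is conjugate to one with last entry zero. -/
lemma HomRep.subsingleton_of_invariants (h : HomRep d ρ) (hdn : d ≤ n)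
    (h0 : invariants ρ = ⊥) (v : V) : v = 0 := by
  have hw : ∀ μ, weightSpace ρ μ = ⊥ := fun μ => by
    by_contra hμ
    obtain ⟨hpos, hsum⟩ := h.isPolynomial.weights μ hμ
    -- Otherwise n+1 positive integers would have sum d ≤ n.
    obtain ⟨i, hi⟩ : ∃ i, μ i = 0 := by
      by_contra! hne
      have h1 : ∑ _i : Fin (n + 1), (1 : ℤ) ≤ ∑ i, μ i :=
        Finset.sum_le_sum fun i _ => by have := hpos i; have := hne i; omega
      simp only [Finset.sum_const, Finset.card_univ, Fintype.card_fin,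
        nsmul_eq_mul, mul_one] at h1
      omega
    obtain ⟨w, hw, hw0⟩ := (Submodule.ne_bot_iff _).1
      (weightSpace_comp_perm_ne_bot hμ (Equiv.swap i (Fin.last n)))
    refine hw0 ((Submodule.eq_bot_iff _).1 h0 w fun s => ?_)
    rw [subtorus_weight hw]
    simp [hi]
  have hv : v ∈ ⨆ μ, weightSpace ρ μ := by
    rw [iSup_weightSpace h.isPolynomial.rational]; trivial
  simpa [hw] using hv

/-- The action of e on `W` is the restricted one, so `W` has no nonzero invariants. -/
lemma HomRep.eq_bot_of_stable (h : HomRep d ρ) (hdn : d ≤ n) (W : Submodule F V)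
    (hW : ∀ g, W ≤ W.comap (ρ g)) (h0 : ∀ w ∈ W, h.mat (corner 1) w = 0) : W = ⊥ := by
  have hs : HomRep d (ρ.subrepresentation W hW) :=
    h.of_injective W.subtype (fun _ _ => rfl) W.subtype_injective
  refine (Submodule.eq_bot_iff _).2 fun w hw => ?_
  refine congrArg Subtype.val (hs.subsingleton_of_invariants hdn ?_ ⟨w, hw⟩)
  refine (Submodule.eq_bot_iff _).2 fun x hx => Subtype.ext ?_
  rw [hs.mem_invariants_iff] at hx
  have h1 := hs.mat_map h W.subtype (fun _ _ => rfl) (corner 1) x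
  rw [hx] at h1
  exact h1.trans (h0 x.1 x.2)

/-- Invariants of V/W lift to invariants of V by applying e, so V/W has none but zero. -/
lemma HomRep.eq_top_of_stable (h : HomRep d ρ) (hdn : d ≤ n) (W : Submodule F V)
    (hW : ∀ g, W ≤ W.comap (ρ g)) (h0 : invariants ρ ≤ W) : W = ⊤ := by
  have hs : HomRep d (ρ.quotient W hW) :=
    h.of_surjective W.mkQ (fun _ _ => rfl) W.mkQ_surjective
  refine eq_top_iff.2 fun w _ => (Submodule.Quotient.mk_eq_zero W).1 ?_
  refine hs.subsingleton_of_invariants hdn ((Submodule.eq_bot_iff _).2 fun x hx => ?_) _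
  obtain ⟨y, rfl⟩ := W.mkQ_surjective x
  rw [hs.mem_invariants_iff, ← h.mat_map hs W.mkQ (fun _ _ => rfl)] at hx
  rw [← hx]
  exact (Submodule.Quotient.mk_eq_zero W).2 (h0 (h.corner_mem_invariants 1 y))

/-- The equalizer of two maps that agree on invariants is a subrepresentation containing them all.
-/
lemma tau_faithful (hdn : d ≤ n) : (tau F n d).Faithful where
  map_injective {M N f f'} hff := by
    have hM := M.homRep
    let W : Submodule F M.obj.V :=
      LinearMap.eqLocus f.hom.hom.toLinearMap f'.hom.hom.toLinearMap
    have hW : W = ⊤ := hM.eq_top_of_stable hdn W (fun g w hw => by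
        have h1 : f.hom.hom w = f'.hom.hom w := hw
        change f.hom.hom (M.obj.ρ g w) = f'.hom.hom (M.obj.ρ g w)
        rw [Rep.hom_comm_apply, Rep.hom_comm_apply, h1]) fun w hw => by
      have h1 := congrArg (fun k : (tau F n d).obj M ⟶ (tau F n d).obj N =>
        k.hom.hom ⟨w, hw⟩) hff
      exact congrArg Subtype.val h1
    apply ObjectProperty.hom_ext
    refine Rep.hom_ext (Representation.IntertwiningMap.ext (LinearMap.ext fun w => ?_))
    have hw : w ∈ W := hW ▸ Submodule.mem_top
    exact hw

/-! ### Extending a map of invariants to the whole representation. -/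

variable {V' : Type*} [AddCommGroup V'] [Module F V']
  {ρ' : Representation F (GL (Fin (n + 1)) F) V'}

/-- The subrepresentation of `V × V'` generated by the graph of a map `V^S → V'^S`. -/
def graphSpan (h : HomRep d ρ) (h' : HomRep d ρ') (φ : invariants ρ →ₗ[F] invariants ρ') :
    Submodule F (V × V') :=
  Submodule.span F {p | ∃ (x : Matrix (Fin (n + 1)) (Fin (n + 1)) F) (m : invariants ρ),
    p = (h.mat x m, h'.mat x (φ m))}

variable {h : HomRep d ρ} {h' : HomRep d ρ'} {φ : invariants ρ →ₗ[F] invariants ρ'}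

lemma graphSpan_stable (g : GL (Fin (n + 1)) F) {p : V × V'} (hp : p ∈ graphSpan h h' φ) :
    (ρ g p.1, ρ' g p.2) ∈ graphSpan h h' φ := by
  induction hp using Submodule.span_induction with
  | mem p hp =>
    obtain ⟨x, m, rfl⟩ := hp
    refine Submodule.subset_span ⟨g.val * x, m, ?_⟩
    simp only [h.mat_mul, h'.mat_mul, h.mat_GL, h'.mat_GL]
  | zero =>
    simp only [Prod.fst_zero, Prod.snd_zero, map_zero]
    exact zero_mem _
  | add a b _ _ ha hb =>
    have := add_mem ha hb
    simpa using this
  | smul c a _ ha =>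
    have := Submodule.smul_mem _ c ha
    simpa using this

/-- After applying e the generated subrepresentation is still contained in the graph of φ: if e x e
= `corner a`, then (x m, x φ(m)) becomes (a m, a φ(m)), and φ commutes with a. -/
lemma graphSpan_corner (hφ : ∀ g m, φ (invRep ρ g m) = invRep ρ' g (φ m)) {p : V × V'}
    (hp : p ∈ graphSpan h h' φ) :
    h'.mat (corner 1) p.2 = (φ ⟨h.mat (corner 1) p.1, h.corner_mem_invariants 1 p.1⟩).1 := by
  let e : V →ₗ[F] invariants ρ :=
    (h.mat (corner 1)).codRestrict (invariants ρ) (h.corner_mem_invariants 1)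
  change h'.mat (corner 1) p.2 = (φ (e p.1)).1
  induction hp using Submodule.span_induction with
  | mem p hp =>
    obtain ⟨x, m, rfl⟩ := hp
    obtain ⟨a, ha⟩ := exists_corner_mul_mul_corner x
    have h1 : e (h.mat x m) = h.invRep.mat a m := by
      apply Subtype.ext
      rw [h.invRep_mat, ← ha, h.mat_mul, (h.mem_invariants_iff _).1 m.2, h.mat_mul]
      rfl
    simp only
    rw [h1, h.invRep.mat_map h'.invRep φ hφ, h'.invRep_mat, ← ha, h'.mat_mul,
      (h'.mem_invariants_iff _).1 (φ m).2, h'.mat_mul]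
  | zero => simp
  | add a b _ _ ha hb => simp [ha, hb]
  | smul c a _ ha => simp [ha]

/-- The vectors w with (0, w) in the span form a subrepresentation of V' killed by e. -/
lemma graphSpan_injective (hdn : d ≤ n) (hφ : ∀ g m, φ (invRep ρ g m) = invRep ρ' g (φ m)) {v' : V'}
    (hv : ((0 : V), v') ∈ graphSpan h h' φ) : v' = 0 := by
  let W : Submodule F V' := (graphSpan h h' φ).comap (LinearMap.inr F V V')
  have hW : W = ⊥ := h'.eq_bot_of_stable hdn W (fun g w hw => by
      have := graphSpan_stable g hw
      simpa [W] using this) fun w hw => by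
    rw [graphSpan_corner hφ (p := ((0 : V), w)) hw]
    have : (⟨h.mat (corner 1) ((0 : V), w).1, h.corner_mem_invariants 1 _⟩ : invariants ρ) = 0 :=
      Subtype.ext (map_zero _)
    rw [this, map_zero]
    rfl
  exact (Submodule.eq_bot_iff _).1 hW v' hv

/-- The projection of the span to V is a subrepresentation containing the invariants. -/
lemma graphSpan_surjective (hdn : d ≤ n) (v : V) : ∃ v', (v, v') ∈ graphSpan h h' φ := by
  let W : Submodule F V := (graphSpan h h' φ).map (LinearMap.fst F V V')
  have hW : W = ⊤ := h.eq_top_of_stable hdn W (fun g w hw => by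
      obtain ⟨p, hp, rfl⟩ := hw
      exact ⟨_, graphSpan_stable g hp, rfl⟩) fun w hw =>
    ⟨_, Submodule.subset_span ⟨1, ⟨w, hw⟩, rfl⟩, by simp⟩
  have hv : v ∈ W := hW ▸ Submodule.mem_top
  obtain ⟨p, hp, rfl⟩ := hv
  exact ⟨p.2, hp⟩

lemma exists_extension_of_invariants (h : HomRep d ρ) (h' : HomRep d ρ') (hdn : d ≤ n)
    (hφ : ∀ g m, φ (invRep ρ g m) = invRep ρ' g (φ m)) :
    ∃ f : V →ₗ[F] V', (∀ g v, f (ρ g v) = ρ' g (f v)) ∧ ∀ m : invariants ρ, f m = φ m := by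
  let Γ := graphSpan h h' φ
  let π : Γ →ₗ[F] V := LinearMap.fst F V V' ∘ₗ Γ.subtype
  have hπ : Function.Bijective π := by
    constructor
    · refine (injective_iff_map_eq_zero _).2 ?_
      rintro ⟨⟨v, v'⟩, hp⟩ h0
      obtain rfl : v = 0 := h0
      obtain rfl := graphSpan_injective hdn hφ hp
      rfl
    · intro v
      obtain ⟨v', hv'⟩ := graphSpan_surjective (h := h) (h' := h') (φ := φ) hdn v
      exact ⟨⟨_, hv'⟩, rfl⟩
  let f : V →ₗ[F] V' :=
    LinearMap.snd F V V' ∘ₗ Γ.subtype ∘ₗ (LinearEquiv.ofBijective π hπ).symm.toLinearMap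
  have hf : ∀ p ∈ Γ, f p.1 = p.2 := fun p hp => by
    have h1 : (LinearEquiv.ofBijective π hπ).symm p.1 = ⟨p, hp⟩ := by
      rw [LinearEquiv.symm_apply_eq]; rfl
    simp only [f, LinearMap.comp_apply, LinearEquiv.coe_coe, h1]
    rfl
  refine ⟨f, fun g v => ?_, fun m => ?_⟩
  · obtain ⟨v', hv'⟩ := graphSpan_surjective (h := h) (h' := h') (φ := φ) hdn v
    rw [hf _ hv']
    exact hf _ (graphSpan_stable g hv')
  · have := hf _ (Submodule.subset_span ⟨1, m, rfl⟩ : (h.mat 1 m, h'.mat 1 (φ m)) ∈ Γ)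
    simpa using this

lemma tau_full (hdn : d ≤ n) : (tau F n d).Full where
  map_surjective {M N} k := by
    obtain ⟨f, hf, hfk⟩ := exists_extension_of_invariants (φ := k.hom.hom.toLinearMap)
      M.homRep N.homRep hdn fun g m => Rep.hom_comm_apply k.hom g m
    refine ⟨ObjectProperty.homMk (Rep.ofHom ⟨f, fun g => LinearMap.ext (hf g)⟩), ?_⟩
    apply ObjectProperty.hom_ext
    refine Rep.hom_ext (Representation.IntertwiningMap.ext (LinearMap.ext fun m => ?_))
    exact Subtype.ext (hfk m)

theorem tau_isEquivalence (hdn : d ≤ n) : (tau F n d).IsEquivalence where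
  faithful := tau_faithful hdn
  full := tau_full hdn
  essSurj := tau_essSurj

theorem tauIter_isEquivalence (hdn : d ≤ n) (k : ℕ) : (tauIter F n d k).IsEquivalence := by
  induction k with
  | zero => exact inferInstanceAs (𝟭 _ : PolRep F n d ⥤ PolRep F n d).IsEquivalence
  | succ k ih =>
    have := tau_isEquivalence (F := F) (hdn.trans (Nat.le_add_right n k))
    exact inferInstanceAs (tau F (n + k) d ⋙ tauIter F n d k).IsEquivalence

end Equivalence

end PolyGL

end

theorem mainTheorem9 (F : Type u) [Field F] [IsAlgClosed F] (n d : ℕ) (hn : 1 ≤ n) :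
    -- `τ` is exact
    (PreservesFiniteLimits (PolyGL.tau F n d) ∧ PreservesFiniteColimits (PolyGL.tau F n d)) ∧
    -- `τ` sends `Δ(λ,0)` to `Δ(λ)` and `L(λ,0)` to `L(λ)`
    (∀ wt : Fin n → ℤ, Antitone wt → (∀ i, 0 ≤ wt i) → ∑ i, wt i = d →
      (∃ (h : PolyGL.polProp F (n + 1) d (PolyGL.weyl F (Fin.snoc wt 0 : Fin (n + 1) → ℤ)))
        (h' : PolyGL.polProp F n d (PolyGL.weyl F wt)),
        Nonempty ((PolyGL.tau F n d).obj ⟨_, h⟩ ≅ ⟨_, h'⟩)) ∧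
      (∃ (h : PolyGL.polProp F (n + 1) d (PolyGL.irr F (Fin.snoc wt 0 : Fin (n + 1) → ℤ)))
        (h' : PolyGL.polProp F n d (PolyGL.irr F wt)),
        Nonempty ((PolyGL.tau F n d).obj ⟨_, h⟩ ≅ ⟨_, h'⟩))) ∧
    -- for `n ≥ d`, `τ` is an equivalence
    (d ≤ n → (PolyGL.tau F n d).IsEquivalence) ∧
    -- hence all `Rep^d(GL_m)` with `m ≥ d` are equivalent to the stable category `Rep^d(GL)`
    (∀ k : ℕ, (PolyGL.tauIter F (max 1 d) d k :
      PolyGL.PolRep F (max 1 d + k) d ⥤ PolyGL.StableRep F d).IsEquivalence) := by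
  -- The block arguments for Weyl modules of both groups single out a last coordinate, so the
  -- smaller group is written as `GL_{m+1}`.
  obtain ⟨n, rfl⟩ : ∃ m, n = m + 1 := ⟨n - 1, by omega⟩
  exact ⟨⟨PolyGL.tau_preservesFiniteLimits F _ d, PolyGL.tau_preservesFiniteColimits F _ d⟩,
    fun wt _ hwt hd => ⟨PolyGL.tau_weyl hwt hd, PolyGL.tau_irr hwt hd⟩,
    fun hdn => PolyGL.tau_isEquivalence hdn,
    fun k => PolyGL.tauIter_isEquivalence (le_max_right 1 d) k⟩
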